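/- Let $m\ge 1$ and $N\ge 2$ be integers. Coupons of $N$ types are drawn independently, each draw being of type $i$ with probability $p_i$, where $p=(p_1,\dots,p_N)$, $p_i>0$, $\sum_i p_i=1$. Let $T_m(N)$ be the number of draws needed until at least $m$ copies of each of the $N$ types have been collected. For every such $p$, $T_m(N)$ is almost surely finite and square-integrable; put $$V_{m,N}(p)=\operatorname{Var}_p(T_m(N)).$$ Let $u=(1/N,\dots,1/N)$ be the uniform vector. Then the function $h\mapsto V_{m,N}(u+h)$, defined for $h$ near $0$ in the tangent space $\{h\in\mathbb R^N:\sum_{i=1}^N h_i=0\}$, is twice continuously differentiable at $h=0$, and there is a constant $C_{m,N}>0$, depending only on $m$ and $N$, such that for every $h\in\mathbb R^N$ with $\sum_{i=1}^N h_i=0$, $$D^2V_{m,N}(u)[h,h]=C_{m,N}\sum_{i=1}^N h_i^2 .$$ -/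

import Mathlib

open MeasureTheory ProbabilityTheory

/-- The law of one coupon draw on the `N` coupon types: type `i` has mass `p i`. -/
noncomputable def couponLaw {N : ℕ} (p : Fin N → ℝ) : Measure (Fin N) :=
  ∑ i, ENNReal.ofReal (p i) • Measure.dirac i

/-- For a probability vector `p`, `couponLaw p` is a probability measure. -/
theorem isProbabilityMeasure_couponLaw {N : ℕ} (p : Fin N → ℝ) (h0 : ∀ i, 0 ≤ p i)
    (h1 : ∑ i, p i = 1) : IsProbabilityMeasure (couponLaw p) := by
  constructor
  simp only [couponLaw, Measure.coe_finsetSum, Finset.sum_apply, Measure.smul_apply,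
    measure_univ, smul_eq_mul, mul_one]
  rw [← ENNReal.ofReal_sum_of_nonneg (fun i _ => h0 i), h1, ENNReal.ofReal_one]

/-- For a probability vector `p`, `couponLaw p` gives coupon type `i` the probability `p i`. -/
theorem couponLaw_singleton {N : ℕ} (p : Fin N → ℝ) (i : Fin N) :
    couponLaw p {i} = ENNReal.ofReal (p i) := by
  simp [couponLaw, Measure.coe_finsetSum, Finset.sum_apply, Set.indicator_apply]

/-- The law of the whole sequence of draws: `ω k` is the type of the `(k + 1)`-st coupon, and the
draws are independent with common law `couponLaw p`. -/
noncomputable def drawLaw {N : ℕ} (p : Fin N → ℝ) : Measure (ℕ → Fin N) :=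
  Measure.infinitePi (fun _ : ℕ => couponLaw p)

/-- The number of copies of coupon type `i` among the first `n` draws. -/
def copies {N : ℕ} (ω : ℕ → Fin N) (n : ℕ) (i : Fin N) : ℕ :=
  ((Finset.range n).filter (fun k => ω k = i)).card

/-- After `n` draws, at least `m` copies of every coupon type have been collected. -/
def HasCompleteSets {N : ℕ} (m : ℕ) (ω : ℕ → Fin N) (n : ℕ) : Prop :=
  ∀ i : Fin N, m ≤ copies ω n i

/-- The number `T_m(N)` of draws needed to collect at least `m` copies of each of the `N` coupon
types (with the value `0` on the sequences that never achieve this). -/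
noncomputable def collectTime {N : ℕ} (m : ℕ) (ω : ℕ → Fin N) : ℕ :=
  sInf {n : ℕ | HasCompleteSets m ω n}

/-- `V_{m,N}(p) = Var_p(T_m(N))`. -/
noncomputable def collectVar (m N : ℕ) (p : Fin N → ℝ) : ℝ :=
  Var[fun ω : ℕ → Fin N => (collectTime m ω : ℝ); drawLaw p]

/-- The uniform probability vector `u = (1/N, …, 1/N)`. -/
noncomputable def uniformVec (N : ℕ) : Fin N → ℝ := fun _ => 1 / (N : ℝ)

/-- The tangent space of the probability simplex: the vectors `h` with `∑ i, h i = 0`. -/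
def tangentDirections (N : ℕ) : Submodule ℝ (Fin N → ℝ) where
  carrier := {h | ∑ i, h i = 0}
  zero_mem' := by simp
  add_mem' := by
    intro a b ha hb
    simp only [Set.mem_ofPred_eq] at ha hb
    simp [Finset.sum_add_distrib, ha, hb]
  smul_mem' := by
    intro c a ha
    simp only [Set.mem_ofPred_eq] at ha
    simp [← Finset.mul_sum, ha]

/-- `V_{m,N}` in the affine coordinate `h ↦ u + h` of the hyperplane `∑ i, p i = 1` around the
uniform vector; near `h = 0`, the vector `u + h` is a positive probability vector. -/
noncomputable def collectVarAtUniform (m N : ℕ) (h : tangentDirections N) : ℝ :=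
  collectVar m N (uniformVec N + (h : Fin N → ℝ))

/-! Poissonization reduces the variance to integrals of an explicit product. Let the draws arrive at
the points of a rate-one Poisson process: the types become independent, and the probability of being
incomplete at time `t` is `1 - ∏ i, F (p i * t)`, where `F` is the distribution function of the
`m`-th point. Writing `J_j` for the integral of `t ^ j` against this tail, the first two moments of
the discrete time give `Var T = 2 * J_1 - J_0 - J_0 ^ 2` (`collectVar_eq`). Inclusion-exclusion
makes each `J_j` a rational function of `p`, hence smooth.

At the uniform vector the first derivatives of `J_j` vanish in tangent directions, and symmetry
makes the second derivative `(∑ i, h i ^ 2) * K_j`. Here `K_j` is the integral of `t ^ j` against `t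
^ 2 * F ^ (N - 2) * (f ^ 2 - F * f')`, with `f = F'` and arguments `t / N`. So the constant is `2 *
K_1 - K_0 - 2 * J_0 * K_0`, and its positivity remains.

Let `g` be the density of the uniform completion time and `G` the primitive of `F`. The weight in
`K_j` equals `N * t * g * (1 + G / F)` (`curvatureDensity_eq`), and `G / F` increases
(`monotoneOn_erlangCDFPrimitive_div`). A Chebyshev-type comparison with the weight `t * g`, whose
mean is `2 * J_1 / J_0`, gives `K_1 / K_0 ≥ 2 * J_1 / J_0`. Nonnegativity of the variance itself
gives `2 * J_1 / J_0 ≥ 1 + J_0`. Hence `2 * K_1 ≥ 2 * (1 + J_0) * K_0`, which exceeds `(1 + 2 * J_0)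
* K_0` because `K_0 > 0`. -/

/-! ### Counting copies: a one-step recursion in the number of draws. -/

/-- The event that after `n` draws at least `a i` copies of each type `i` are present. -/
def atLeastCopies {N : ℕ} (a : Fin N → ℕ) (n : ℕ) : Set (ℕ → Fin N) :=
  {ω | ∀ i, a i ≤ copies ω n i}

theorem copies_succ {N : ℕ} (ω : ℕ → Fin N) (n : ℕ) (i : Fin N) :
    copies ω (n + 1) i = copies ω n i + if ω n = i then 1 else 0 := by
  unfold copies
  rw [Finset.range_add_one, Finset.filter_insert]
  split_ifs with h
  · rw [Finset.card_insert_of_notMem (by simp)]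
  · rfl

theorem copies_congr {N : ℕ} {ω ω' : ℕ → Fin N} {n : ℕ} (h : ∀ k < n, ω k = ω' k) (i : Fin N) :
    copies ω n i = copies ω' n i := by
  unfold copies
  congr 1
  refine Finset.filter_congr fun k hk => ?_
  rw [h k (Finset.mem_range.1 hk)]

/-- If the last draw is `i`, it supplies one copy of `i`, so the quota of `i` drops by one. Quotas
must vary with the type for this to close up as a recursion; truncated subtraction is right for a
quota already at `0`. -/
theorem atLeastCopies_succ_inter {N : ℕ} (a : Fin N → ℕ) (n : ℕ) (i : Fin N) :
    atLeastCopies a (n + 1) ∩ {ω | ω n = i}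
      = atLeastCopies (Function.update a i (a i - 1)) n ∩ {ω | ω n = i} := by
  ext ω
  simp only [atLeastCopies, Set.mem_inter_iff, Set.mem_ofPred_eq, copies_succ]
  refine and_congr_left fun hi => forall_congr' fun j => ?_
  subst hi
  by_cases hj : j = ω n
  · subst hj
    simp
  · simp [Function.update_of_ne hj, Ne.symm hj]

theorem exists_atLeastCopies_eq_preimage {N : ℕ} (a : Fin N → ℕ) (n : ℕ) :
    ∃ s : Set (Finset.range n → Fin N),
      atLeastCopies a n = (fun ω (k : Finset.range n) => ω k) ⁻¹' s := by
  refine ⟨(fun ω (k : Finset.range n) => ω k) '' atLeastCopies a n, ?_⟩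
  refine Set.Subset.antisymm (Set.subset_preimage_image _ _) ?_
  rintro ω ⟨ω', hω', h⟩ i
  have : copies ω n i = copies ω' n i :=
    copies_congr (fun k hk => (congrFun h ⟨k, Finset.mem_range.2 hk⟩).symm) i
  rw [this]
  exact hω' i

theorem measurableSet_atLeastCopies {N : ℕ} (a : Fin N → ℕ) (n : ℕ) :
    MeasurableSet (atLeastCopies a n) := by
  obtain ⟨s, hs⟩ := exists_atLeastCopies_eq_preimage a n
  rw [hs]
  exact (by fun_prop : Measurable fun (ω : ℕ → Fin N) (k : Finset.range n) => ω k)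
    (Set.toFinite s).measurableSet

theorem isProbabilityMeasure_drawLaw {N : ℕ} {p : Fin N → ℝ} (h0 : ∀ i, 0 ≤ p i)
    (h1 : ∑ i, p i = 1) : IsProbabilityMeasure (drawLaw p) := by
  have := isProbabilityMeasure_couponLaw p h0 h1
  unfold drawLaw
  infer_instance

theorem drawLaw_atLeastCopies_inter {N : ℕ} {p : Fin N → ℝ} (h0 : ∀ i, 0 ≤ p i)
    (h1 : ∑ i, p i = 1) (a : Fin N → ℕ) (n : ℕ) (i : Fin N) :
    (drawLaw p).real (atLeastCopies a n ∩ {ω | ω n = i})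
      = p i * (drawLaw p).real (atLeastCopies a n) := by
  have := isProbabilityMeasure_couponLaw p h0 h1
  obtain ⟨s, hs⟩ := exists_atLeastCopies_eq_preimage a n
  have hind : iIndepFun (fun (k : ℕ) (ω : ℕ → Fin N) => ω k) (drawLaw p) :=
    iIndepFun_infinitePi (P := fun _ : ℕ => couponLaw p) (X := fun _ x => x)
      (fun _ => measurable_id)
  -- The event depends only on draws `0, …, n - 1`, which are independent of draw `n`.
  have h2 := hind.indepFun_finset (Finset.range n) {n} (by simp) (fun k => measurable_pi_apply k)
  have h3 := h2.measure_inter_preimage_eq_mul s {x | x ⟨n, by simp⟩ = i}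
    (Set.toFinite _).measurableSet (Set.toFinite _).measurableSet
  have h4 : (drawLaw p) {ω | ω n = i} = ENNReal.ofReal (p i) := by
    have h5 := (measurePreserving_eval_infinitePi (fun _ : ℕ => couponLaw p) n).measure_preimage
      (measurableSet_singleton i).nullMeasurableSet
    rw [couponLaw_singleton] at h5
    exact h5
  have h6 : (fun (ω : ℕ → Fin N) (k : ({n} : Finset ℕ)) => ω k) ⁻¹' {x | x ⟨n, by simp⟩ = i}
      = {ω | ω n = i} := rfl
  rw [h6, h4, ← hs] at h3
  rw [Measure.real, h3, ENNReal.toReal_mul, ENNReal.toReal_ofReal (h0 i), mul_comm, Measure.real]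

theorem drawLaw_atLeastCopies_succ {N : ℕ} {p : Fin N → ℝ} (h0 : ∀ i, 0 ≤ p i)
    (h1 : ∑ i, p i = 1) (a : Fin N → ℕ) (n : ℕ) :
    (drawLaw p).real (atLeastCopies a (n + 1))
      = ∑ i, p i * (drawLaw p).real (atLeastCopies (Function.update a i (a i - 1)) n) := by
  have := isProbabilityMeasure_drawLaw h0 h1
  have hU : atLeastCopies a (n + 1) = ⋃ i ∈ (Finset.univ : Finset (Fin N)),
      (atLeastCopies a (n + 1) ∩ {ω | ω n = i}) := by
    ext ω
    simp
  rw [hU, measureReal_biUnion_finset]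
  · refine Finset.sum_congr rfl fun i _ => ?_
    rw [atLeastCopies_succ_inter, drawLaw_atLeastCopies_inter h0 h1]
  · intro i _ j _ hij
    refine Set.disjoint_left.2 fun ω hω hω' => hij ?_
    exact hω.2.symm.trans hω'.2
  · intro i _
    have hm : Measurable fun ω : ℕ → Fin N => ω n := measurable_pi_apply n
    exact (measurableSet_atLeastCopies _ _).inter (hm (measurableSet_singleton i))

theorem drawLaw_atLeastCopies_zero {N : ℕ} {p : Fin N → ℝ} (h0 : ∀ i, 0 ≤ p i)
    (h1 : ∑ i, p i = 1) (a : Fin N → ℕ) :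
    (drawLaw p).real (atLeastCopies a 0) = if a = 0 then 1 else 0 := by
  have := isProbabilityMeasure_drawLaw h0 h1
  split_ifs with h
  · have : atLeastCopies a 0 = Set.univ := by
      ext ω
      simp [atLeastCopies, h]
    rw [this]
    simp
  · have : atLeastCopies a 0 = ∅ := by
      ext ω
      simp only [atLeastCopies, copies, Finset.range_zero, Finset.filter_empty, Finset.card_empty,
        nonpos_iff_eq_zero, Set.mem_ofPred_eq, Set.mem_empty_iff_false, iff_false]
      exact fun h' => h (funext h')
    rw [this]
    simp

/-! ### Exponential generating functions of the completion probabilities. -/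

/-- The exponential series without its first `a` terms. -/
noncomputable def expTail (a : ℕ) (z : ℂ) : ℂ :=
  Complex.exp z - ∑ k ∈ Finset.range a, z ^ k / (k.factorial : ℂ)

theorem hasDerivAt_sum_pow_div_factorial (a : ℕ) (z : ℂ) :
    HasDerivAt (fun z : ℂ => ∑ k ∈ Finset.range (a + 1), z ^ k / (k.factorial : ℂ))
      (∑ k ∈ Finset.range a, z ^ k / (k.factorial : ℂ)) z := by
  induction a with
  | zero => simpa using hasDerivAt_const z (1 : ℂ)
  | succ a ih =>
    rw [funext fun z : ℂ => Finset.sum_range_succ (fun k => z ^ k / (k.factorial : ℂ)) (a + 1),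
      Finset.sum_range_succ]
    refine ih.fun_add (((hasDerivAt_pow (a + 1) z).div_const _).congr_deriv ?_)
    rw [Nat.factorial_succ]
    have : ((a : ℂ) + 1) ≠ 0 := by exact_mod_cast Nat.succ_ne_zero a
    have := Nat.factorial_ne_zero a
    push_cast
    field_simp

theorem hasDerivAt_expTail (a : ℕ) (z : ℂ) : HasDerivAt (expTail a) (expTail (a - 1) z) z := by
  cases a with
  | zero =>
    have : expTail 0 = Complex.exp := by
      funext z
      simp [expTail]
    simpa [this] using Complex.hasDerivAt_exp z
  | succ a => exact (Complex.hasDerivAt_exp z).sub (hasDerivAt_sum_pow_div_factorial a z)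

theorem expTail_zero (a : ℕ) : expTail a 0 = if a = 0 then 1 else 0 := by
  cases a with
  | zero => simp [expTail]
  | succ a => simp [expTail, Finset.sum_range_succ']

/-- The product `∏ i, expTail (a i) (p i * z)`. -/
noncomputable def expTailProd {N : ℕ} (p : Fin N → ℝ) (a : Fin N → ℕ) (z : ℂ) : ℂ :=
  ∏ i, expTail (a i) ((p i : ℂ) * z)

theorem hasDerivAt_expTailProd {N : ℕ} (p : Fin N → ℝ) (a : Fin N → ℕ) (z : ℂ) :
    HasDerivAt (expTailProd p a)
      (∑ i, (p i : ℂ) * expTailProd p (Function.update a i (a i - 1)) z) z := by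
  have h : ∀ i ∈ (Finset.univ : Finset (Fin N)),
      HasDerivAt (fun z : ℂ => expTail (a i) ((p i : ℂ) * z))
      (expTail (a i - 1) ((p i : ℂ) * z) * (p i : ℂ)) z := fun i _ => by
    exact ((hasDerivAt_expTail (a i) ((p i : ℂ) * z)).comp z
      ((hasDerivAt_id z).const_mul (p i : ℂ))).congr_deriv (by simp)
  refine (HasDerivAt.fun_finsetProd h).congr_deriv (Finset.sum_congr rfl fun i _ => ?_)
  rw [expTailProd, ← Finset.mul_prod_erase Finset.univ _ (Finset.mem_univ i), Function.update_self,
    smul_eq_mul]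
  have : ∏ j ∈ Finset.univ.erase i, expTail (Function.update a i (a i - 1) j) ((p j : ℂ) * z)
      = ∏ j ∈ Finset.univ.erase i, expTail (a j) ((p j : ℂ) * z) :=
    Finset.prod_congr rfl fun j hj => by rw [Function.update_of_ne (Finset.ne_of_mem_erase hj)]
  rw [this]
  ring

theorem differentiable_expTailProd {N : ℕ} (p : Fin N → ℝ) (a : Fin N → ℕ) :
    Differentiable ℂ (expTailProd p a) :=
  fun z => (hasDerivAt_expTailProd p a z).differentiableAt

/-- Differentiating the product lowers one quota at a time with weight `p i`, exactly the recursion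
of `drawLaw_atLeastCopies_succ`; the values at `0` match the empty draw. -/
theorem iteratedDeriv_expTailProd_zero {N : ℕ} {p : Fin N → ℝ} (h0 : ∀ i, 0 ≤ p i)
    (h1 : ∑ i, p i = 1) (n : ℕ) (a : Fin N → ℕ) :
    iteratedDeriv n (expTailProd p a) 0 = ((drawLaw p).real (atLeastCopies a n) : ℂ) := by
  induction n generalizing a with
  | zero =>
    rw [drawLaw_atLeastCopies_zero h0 h1, iteratedDeriv_zero, expTailProd]
    simp only [mul_zero, expTail_zero]
    split_ifs with h
    · simp [h]
    · obtain ⟨i, hi⟩ := Function.ne_iff.1 h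
      rw [Finset.prod_eq_zero (Finset.mem_univ i) (if_neg hi)]
      simp
  | succ n ih =>
    have hc : ∀ b, ContDiffAt ℂ n (expTailProd p b) 0 :=
      fun b => (differentiable_expTailProd p b).contDiff.contDiffAt
    rw [iteratedDeriv_succ', funext fun z => (hasDerivAt_expTailProd p a z).deriv,
      iteratedDeriv_fun_sum (fun i _ => contDiffAt_const.mul (hc _)),
      drawLaw_atLeastCopies_succ h0 h1]
    push_cast
    refine Finset.sum_congr rfl fun i _ => ?_
    rw [iteratedDeriv_const_mul _ (hc _), ih]

theorem hasSum_drawLaw_atLeastCopies {N : ℕ} {p : Fin N → ℝ} (h0 : ∀ i, 0 ≤ p i)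
    (h1 : ∑ i, p i = 1) (a : Fin N → ℕ) (t : ℝ) :
    HasSum (fun n : ℕ => (drawLaw p).real (atLeastCopies a n) * (t ^ n / n.factorial))
      (∏ i, (Real.exp (p i * t) - ∑ k ∈ Finset.range (a i), (p i * t) ^ k / (k.factorial : ℝ))) := by
  -- Working over `ℂ` makes convergence everywhere automatic, since the product is entire.
  have h := Complex.hasSum_taylorSeries_of_entire (differentiable_expTailProd p a) 0 (t : ℂ)
  simp only [iteratedDeriv_expTailProd_zero h0 h1, sub_zero, smul_eq_mul] at h
  refine Complex.hasSum_ofReal.1 ?_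
  have e : ((∏ i, (Real.exp (p i * t) - ∑ k ∈ Finset.range (a i),
      (p i * t) ^ k / (k.factorial : ℝ)) : ℝ) : ℂ) = expTailProd p a t := by
    simp [expTailProd, expTail]
  rw [e]
  refine Eq.mp (congrArg (fun f => HasSum f _) (funext fun n => ?_)) h
  push_cast
  ring

/-! ### Poissonization and inclusion-exclusion. -/

/-- The mass of `k` under the Poisson law of mean `x`, which is also the density at `x` of the
time of the `(k + 1)`-st point of a Poisson process of rate one. -/
noncomputable def poissonMass (k : ℕ) (x : ℝ) : ℝ := Real.exp (-x) * (x ^ k / k.factorial)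

/-- The probability that the `m`-th point of a Poisson process of rate one comes after time `x`. -/
noncomputable def erlangTail (m : ℕ) (x : ℝ) : ℝ := ∑ k ∈ Finset.range m, poissonMass k x

/-- The distribution function of the `m`-th point of a Poisson process of rate one. -/
noncomputable def erlangCDF (m : ℕ) (x : ℝ) : ℝ := 1 - erlangTail m x

/-- The probability that the Poissonized collection with rates `p` is not complete at time `t`. -/
noncomputable def poissonTail {N : ℕ} (m : ℕ) (p : Fin N → ℝ) (t : ℝ) : ℝ :=
  1 - ∏ i, erlangCDF m (p i * t)

theorem exp_mul_erlangCDF (m : ℕ) (x : ℝ) : Real.exp (-x) *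
    (Real.exp x - ∑ k ∈ Finset.range m, x ^ k / (k.factorial : ℝ)) = erlangCDF m x := by
  rw [mul_sub, ← Real.exp_add, neg_add_cancel, Real.exp_zero, Finset.mul_sum]
  rfl

/-- Conditioning on the Poisson number of draws made by time `t`. The factor `exp (-t)` splits over
the types because the `p i` sum to one. -/
theorem hasSum_poissonTail {N : ℕ} {p : Fin N → ℝ} (h0 : ∀ i, 0 ≤ p i)
    (h1 : ∑ i, p i = 1) (m : ℕ) (t : ℝ) :
    HasSum (fun n : ℕ => (1 - (drawLaw p).real (atLeastCopies (fun _ => m) n)) * poissonMass n t)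
      (poissonTail m p t) := by
  have hA := (hasSum_drawLaw_atLeastCopies h0 h1 (fun _ => m) t).mul_left (Real.exp (-t))
  have hB := (NormedSpace.expSeries_div_hasSum_exp (𝔸 := ℝ) t).mul_left (Real.exp (-t))
  rw [← Real.exp_eq_exp_ℝ, ← Real.exp_add, neg_add_cancel, Real.exp_zero] at hB
  have hexp : Real.exp (-t) = ∏ i, Real.exp (-(p i * t)) := by
    rw [← Real.exp_sum, Finset.sum_neg_distrib, ← Finset.sum_mul, h1, one_mul]
  have e : Real.exp (-t) * ∏ i, (Real.exp (p i * t) - ∑ k ∈ Finset.range m,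
      (p i * t) ^ k / (k.factorial : ℝ)) = ∏ i, erlangCDF m (p i * t) := by
    rw [hexp, ← Finset.prod_mul_distrib]
    simp only [exp_mul_erlangCDF]
  rw [e] at hA
  refine Eq.mp (congrArg (fun f => HasSum f _) (funext fun n => ?_)) (hB.sub hA)
  simp only [poissonMass]
  ring

theorem integrableOn_pow_mul_exp_neg_mul (k : ℕ) {c : ℝ} (hc : 0 < c) :
    IntegrableOn (fun t : ℝ => t ^ k * Real.exp (-(c * t))) (Set.Ioi 0) := by
  have h := integrableOn_rpow_mul_exp_neg_mul_rpow (s := k) (p := 1) (b := c)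
    (by have := k.cast_nonneg (α := ℝ); linarith) one_pos hc
  refine h.congr_fun (fun t _ => ?_) measurableSet_Ioi
  simp only [Real.rpow_one, Real.rpow_natCast, neg_mul]

theorem integral_pow_mul_exp_neg_mul (k : ℕ) {c : ℝ} (hc : 0 < c) :
    ∫ t in Set.Ioi (0 : ℝ), t ^ k * Real.exp (-(c * t)) = k.factorial / c ^ (k + 1) := by
  have h := Real.integral_rpow_mul_exp_neg_mul_Ioi (a := k + 1) (r := c) (by positivity) hc
  rw [Real.Gamma_nat_eq_factorial] at h
  simp only [add_sub_cancel_right, Real.rpow_natCast] at h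
  rw [h, ← Nat.cast_succ, Real.rpow_natCast, one_div, inv_pow, Nat.succ_eq_add_one]
  field_simp

theorem prod_erlangTail {N : ℕ} (m : ℕ) (p : Fin N → ℝ) (J : Finset (Fin N)) (t : ℝ) :
    ∏ i ∈ J, erlangTail m (p i * t) =
      ∑ κ ∈ Fintype.piFinset (fun _ : J => Finset.range m),
        (∏ i : J, p i ^ κ i / (κ i).factorial) *
          (t ^ (∑ i, κ i) * Real.exp (-((∑ i ∈ J, p i) * t))) := by
  rw [← Finset.prod_coe_sort]
  simp only [erlangTail]
  rw [Finset.prod_univ_sum]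
  refine Finset.sum_congr rfl fun κ _ => ?_
  rw [← Finset.prod_pow_eq_pow_sum, Finset.sum_mul, ← Finset.sum_coe_sort J,
    ← Finset.sum_neg_distrib, Real.exp_sum, ← Finset.prod_mul_distrib, ← Finset.prod_mul_distrib]
  refine Finset.prod_congr rfl fun i _ => ?_
  rw [poissonMass, mul_pow]
  ring

/-- Inclusion-exclusion over the set `J` of unfinished types. The empty set cancels the leading `1`,
so every remaining term decays exponentially. -/
theorem poissonTail_eq_sum {N : ℕ} (m : ℕ) (p : Fin N → ℝ) (t : ℝ) :
    poissonTail m p t = ∑ J ∈ (Finset.univ : Finset (Finset (Fin N))).erase ∅,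
      -(-1) ^ J.card * ∏ i ∈ J, erlangTail m (p i * t) := by
  simp only [poissonTail, erlangCDF]
  rw [Finset.prod_sub, ← Finset.add_sum_erase _ _ (Finset.empty_mem_powerset _),
    Finset.powerset_univ]
  simp only [neg_mul, Finset.sum_neg_distrib]
  simp

/-! ### Tail moments: integrability, closed form, smoothness. -/

/-- The integral of `t ^ j` against the tail of the completion time of the Poissonized collection
with rates `p`. -/
noncomputable def tailMoment {N : ℕ} (m j : ℕ) (p : Fin N → ℝ) : ℝ :=
  ∫ t in Set.Ioi (0 : ℝ), t ^ j * poissonTail m p t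

theorem pow_mul_poissonTail {N : ℕ} (m j : ℕ) (p : Fin N → ℝ) (t : ℝ) :
    t ^ j * poissonTail m p t = ∑ J ∈ (Finset.univ : Finset (Finset (Fin N))).erase ∅,
      ∑ κ ∈ Fintype.piFinset (fun _ : J => Finset.range m),
        (-(-1) ^ J.card * ∏ i : J, p i ^ κ i / (κ i).factorial) *
          (t ^ (j + ∑ i, κ i) * Real.exp (-((∑ i ∈ J, p i) * t))) := by
  rw [poissonTail_eq_sum, Finset.mul_sum]
  refine Finset.sum_congr rfl fun J _ => ?_
  rw [prod_erlangTail, Finset.mul_sum, Finset.mul_sum]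
  refine Finset.sum_congr rfl fun κ _ => ?_
  rw [pow_add]
  ring

theorem sum_pos_of_mem_erase {N : ℕ} {p : Fin N → ℝ} (hp : ∀ i, 0 < p i) {J : Finset (Fin N)}
    (hJ : J ∈ (Finset.univ : Finset (Finset (Fin N))).erase ∅) : 0 < ∑ i ∈ J, p i :=
  Finset.sum_pos (fun i _ => hp i) (Finset.nonempty_of_ne_empty (Finset.ne_of_mem_erase hJ))

theorem integrableOn_pow_mul_poissonTail {N : ℕ} (m j : ℕ) {p : Fin N → ℝ} (hp : ∀ i, 0 < p i) :
    IntegrableOn (fun t => t ^ j * poissonTail m p t) (Set.Ioi 0) := by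
  simp only [pow_mul_poissonTail]
  exact integrable_finsetSum _ fun J hJ => integrable_finsetSum _ fun κ _ =>
    (integrableOn_pow_mul_exp_neg_mul _ (sum_pos_of_mem_erase hp hJ)).const_mul _

theorem tailMoment_eq_sum {N : ℕ} (m j : ℕ) {p : Fin N → ℝ} (hp : ∀ i, 0 < p i) :
    tailMoment m j p = ∑ J ∈ (Finset.univ : Finset (Finset (Fin N))).erase ∅,
      ∑ κ ∈ Fintype.piFinset (fun _ : J => Finset.range m),
        (-(-1) ^ J.card * ∏ i : J, p i ^ κ i / (κ i).factorial) *
          ((j + ∑ i, κ i).factorial / (∑ i ∈ J, p i) ^ (j + ∑ i, κ i + 1)) := by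
  simp only [tailMoment, pow_mul_poissonTail]
  rw [integral_finsetSum]
  · refine Finset.sum_congr rfl fun J hJ => ?_
    rw [integral_finsetSum]
    · refine Finset.sum_congr rfl fun κ _ => ?_
      rw [integral_const_mul, integral_pow_mul_exp_neg_mul _ (sum_pos_of_mem_erase hp hJ)]
    · exact fun κ _ =>
        (integrableOn_pow_mul_exp_neg_mul _ (sum_pos_of_mem_erase hp hJ)).const_mul _
  · exact fun J hJ => integrable_finsetSum _ fun κ _ =>
      (integrableOn_pow_mul_exp_neg_mul _ (sum_pos_of_mem_erase hp hJ)).const_mul _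

theorem eventually_forall_pos {N : ℕ} {p : Fin N → ℝ} (hp : ∀ i, 0 < p i) :
    ∀ᶠ q in nhds p, ∀ i, 0 < q i :=
  Filter.eventually_all.2 fun i => (continuous_apply i).continuousAt.eventually_const_lt (hp i)

theorem contDiffAt_tailMoment {N : ℕ} (m j : ℕ) {n : WithTop ℕ∞} {p : Fin N → ℝ}
    (hp : ∀ i, 0 < p i) : ContDiffAt ℝ n (tailMoment m j) p := by
  refine ContDiffAt.congr_of_eventuallyEq ?_
    ((eventually_forall_pos hp).mono fun q hq => tailMoment_eq_sum m j hq)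
  refine ContDiffAt.sum fun J hJ => ContDiffAt.sum fun κ _ => ?_
  have hc : ∀ i : Fin N, ContDiffAt ℝ n (fun q : Fin N → ℝ => q i) p := fun i =>
    (ContinuousLinearMap.proj (R := ℝ) (φ := fun _ : Fin N => ℝ) i).contDiff.contDiffAt
  have hprod : ContDiffAt ℝ n (fun q : Fin N → ℝ => ∏ i : J, q i ^ κ i / (κ i).factorial) p :=
    contDiffAt_prod fun i _ => ((hc i).pow _).div_const _
  have hsum : ContDiffAt ℝ n (fun q : Fin N → ℝ => ∑ i ∈ J, q i) p :=
    ContDiffAt.sum fun i _ => hc i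
  exact (contDiffAt_const.mul hprod).mul (ContDiffAt.fun_div contDiffAt_const (hsum.pow _)
    (pow_ne_zero _ (sum_pos_of_mem_erase hp hJ).ne'))

/-! ### Moments of the discrete completion time. -/

theorem hasCompleteSets_mono {N m : ℕ} {ω : ℕ → Fin N} {n k : ℕ} (hnk : n ≤ k)
    (h : HasCompleteSets m ω n) : HasCompleteSets m ω k := by
  intro i
  refine (h i).trans (Finset.card_le_card (Finset.filter_subset_filter _ ?_))
  exact Finset.range_subset_range.2 hnk

theorem lt_collectTime_iff {N m : ℕ} {ω : ℕ → Fin N} (h : ∃ n, HasCompleteSets m ω n) (n : ℕ) :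
    n < collectTime m ω ↔ ¬ HasCompleteSets m ω n := by
  constructor
  · intro hn hc
    exact absurd (Nat.sInf_le (s := {n : ℕ | HasCompleteSets m ω n}) hc) (not_le.2 hn)
  · intro hn
    by_contra hlt
    exact hn (hasCompleteSets_mono (not_lt.1 hlt)
      (Nat.sInf_mem (s := {n : ℕ | HasCompleteSets m ω n}) h))

theorem collectTime_eq_zero_of_not {N m : ℕ} {ω : ℕ → Fin N} (h : ¬ ∃ n, HasCompleteSets m ω n) :
    collectTime m ω = 0 := by
  have : {n : ℕ | HasCompleteSets m ω n} = ∅ :=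
    Set.eq_empty_of_forall_notMem fun n hn => h ⟨n, hn⟩
  rw [collectTime, this, Nat.sInf_empty]

theorem measurableSet_hasCompleteSets {N : ℕ} (m n : ℕ) :
    MeasurableSet {ω : ℕ → Fin N | HasCompleteSets m ω n} :=
  measurableSet_atLeastCopies (fun _ => m) n

theorem measurable_collectTime {N : ℕ} (m : ℕ) :
    Measurable (collectTime m : (ℕ → Fin N) → ℕ) := by
  refine measurable_of_Ioi fun n => ?_
  have : (collectTime m : (ℕ → Fin N) → ℕ) ⁻¹' Set.Ioi n
      -- The union excludes the sequences that never finish, where `collectTime` is `0` by default.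
      = (⋃ k, {ω | HasCompleteSets m ω k}) \ {ω | HasCompleteSets m ω n} := by
    ext ω
    simp only [Set.mem_preimage, Set.mem_Ioi, Set.mem_sdiff, Set.mem_iUnion, Set.mem_ofPred_eq]
    by_cases h : ∃ k, HasCompleteSets m ω k
    · simp [lt_collectTime_iff h, h]
    · simp [collectTime_eq_zero_of_not h, h]
  rw [this]
  exact (MeasurableSet.iUnion fun k => measurableSet_hasCompleteSets m k).diff
    (measurableSet_hasCompleteSets m n)

/-- The probability that the collection is not complete after `n` draws. -/
noncomputable def incompleteProb {N : ℕ} (m : ℕ) (p : Fin N → ℝ) (n : ℕ) : ℝ :=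
  1 - (drawLaw p).real (atLeastCopies (fun _ => m) n)

theorem incompleteProb_nonneg {N : ℕ} {p : Fin N → ℝ} (h0 : ∀ i, 0 ≤ p i) (h1 : ∑ i, p i = 1)
    (m n : ℕ) : 0 ≤ incompleteProb m p n := by
  have := isProbabilityMeasure_drawLaw h0 h1
  exact sub_nonneg.2 measureReal_le_one

theorem drawLaw_not_hasCompleteSets {N : ℕ} {p : Fin N → ℝ} (h0 : ∀ i, 0 ≤ p i)
    (h1 : ∑ i, p i = 1) (m n : ℕ) :
    drawLaw p {ω | ¬ HasCompleteSets m ω n} = ENNReal.ofReal (incompleteProb m p n) := by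
  have := isProbabilityMeasure_drawLaw h0 h1
  have h := probReal_compl_eq_one_sub (μ := drawLaw p)
    (measurableSet_atLeastCopies (fun _ : Fin N => m) n)
  rw [incompleteProb, ← h, ofReal_measureReal]
  rfl

theorem poissonMass_nonneg (k : ℕ) {x : ℝ} (hx : 0 ≤ x) : 0 ≤ poissonMass k x := by
  unfold poissonMass
  positivity

theorem continuous_poissonMass (k : ℕ) : Continuous (poissonMass k) := by
  unfold poissonMass
  fun_prop

theorem lintegral_pow_mul_poissonMass (j n : ℕ) :
    ∫⁻ t in Set.Ioi (0 : ℝ), ENNReal.ofReal (t ^ j * poissonMass n t)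
      = ENNReal.ofReal ((j + n).factorial / n.factorial) := by
  have e : ∀ t : ℝ, t ^ j * poissonMass n t
      = (t ^ (j + n) * Real.exp (-(1 * t))) / n.factorial := fun t => by
    rw [poissonMass, pow_add, one_mul]
    ring
  rw [← ofReal_integral_eq_lintegral_ofReal]
  · simp only [e]
    rw [integral_div, integral_pow_mul_exp_neg_mul _ one_pos, one_pow, div_one]
  · simp only [e]
    exact (integrableOn_pow_mul_exp_neg_mul _ one_pos).div_const _
  · filter_upwards [ae_restrict_mem measurableSet_Ioi] with t ht
    exact mul_nonneg (pow_nonneg (le_of_lt ht) _) (poissonMass_nonneg _ (le_of_lt ht))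

theorem poissonTail_nonneg {N : ℕ} {p : Fin N → ℝ} (h0 : ∀ i, 0 ≤ p i) (h1 : ∑ i, p i = 1)
    (m : ℕ) {t : ℝ} (ht : 0 ≤ t) : 0 ≤ poissonTail m p t :=
  (hasSum_poissonTail h0 h1 m t).nonneg fun n =>
    mul_nonneg (incompleteProb_nonneg h0 h1 m n) (poissonMass_nonneg n ht)

/-- Tonelli applied to the Poisson mixture: integrating `t ^ j` against the mass at `n` gives `(j +
n)! / n!`. Staying in `ENNReal` removes any need for prior summability; finiteness comes from the
right-hand side. -/
theorem tsum_incompleteProb {N : ℕ} {p : Fin N → ℝ} (hp : ∀ i, 0 < p i) (h1 : ∑ i, p i = 1)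
    (m j : ℕ) :
    ∑' n : ℕ, ENNReal.ofReal ((j + n).factorial / n.factorial) *
      ENNReal.ofReal (incompleteProb m p n) = ENNReal.ofReal (tailMoment m j p) := by
  have h0 : ∀ i, 0 ≤ p i := fun i => (hp i).le
  rw [tailMoment, ofReal_integral_eq_lintegral_ofReal (integrableOn_pow_mul_poissonTail m j hp)]
  · have e : ∫⁻ t in Set.Ioi (0 : ℝ), ENNReal.ofReal (t ^ j * poissonTail m p t)
        = ∫⁻ t in Set.Ioi (0 : ℝ), ∑' n : ℕ, ENNReal.ofReal (t ^ j * poissonMass n t) *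
          ENNReal.ofReal (incompleteProb m p n) := by
      refine setLIntegral_congr_fun measurableSet_Ioi fun t ht => ?_
      have ht : 0 ≤ t := le_of_lt ht
      have hs := (hasSum_poissonTail h0 h1 m t).mul_left (t ^ j)
      have hnn : ∀ n, 0 ≤ t ^ j * poissonMass n t :=
        fun n => mul_nonneg (pow_nonneg ht _) (poissonMass_nonneg n ht)
      have e' : ∀ n, t ^ j * ((1 - (drawLaw p).real (atLeastCopies (fun _ => m) n)) *
          poissonMass n t) = t ^ j * poissonMass n t * incompleteProb m p n := fun n => by
        rw [incompleteProb]
        ring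
      simp only [e'] at hs
      rw [← hs.tsum_eq, ENNReal.ofReal_tsum_of_nonneg
        (fun n => mul_nonneg (hnn n) (incompleteProb_nonneg h0 h1 m n)) hs.summable]
      exact tsum_congr fun n => ENNReal.ofReal_mul (hnn n)
    rw [e, lintegral_tsum]
    · refine tsum_congr fun n => ?_
      rw [lintegral_mul_const', lintegral_pow_mul_poissonMass]
      exact ENNReal.ofReal_ne_top
    · intro n
      refine Measurable.aemeasurable ?_
      have := continuous_poissonMass n
      have : Measurable fun t : ℝ => t ^ j * poissonMass n t := by fun_prop
      fun_prop
  · filter_upwards [ae_restrict_mem measurableSet_Ioi] with t ht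
    exact mul_nonneg (pow_nonneg (le_of_lt ht) _) (poissonTail_nonneg h0 h1 m (le_of_lt ht))

theorem tailMoment_nonneg {N : ℕ} {p : Fin N → ℝ} (h0 : ∀ i, 0 ≤ p i) (h1 : ∑ i, p i = 1)
    (m j : ℕ) : 0 ≤ tailMoment m j p :=
  setIntegral_nonneg measurableSet_Ioi fun _ ht =>
    mul_nonneg (pow_nonneg (le_of_lt ht) _) (poissonTail_nonneg h0 h1 m (le_of_lt ht))

/-- For `j = 0` the incompleteness probabilities have a finite sum, so they tend to zero. -/
theorem ae_exists_hasCompleteSets {N : ℕ} {p : Fin N → ℝ} (hp : ∀ i, 0 < p i)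
    (h1 : ∑ i, p i = 1) (m : ℕ) : ∀ᵐ ω ∂(drawLaw p), ∃ n, HasCompleteSets m ω n := by
  have h0 : ∀ i, 0 ≤ p i := fun i => (hp i).le
  have h := tsum_incompleteProb hp h1 m 0
  have h' : ∑' n : ℕ, ENNReal.ofReal (incompleteProb m p n) ≠ ⊤ := by
    have : ∀ n : ℕ, ((n.factorial : ℝ) / n.factorial) = 1 :=
      fun n => div_self (by exact_mod_cast n.factorial_ne_zero)
    simp only [zero_add, this, ENNReal.ofReal_one, one_mul] at h
    rw [h]
    exact ENNReal.ofReal_ne_top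
  have ht := ENNReal.tendsto_atTop_zero_of_tsum_ne_top h'
  rw [ae_iff]
  refine le_antisymm (ge_of_tendsto' ht fun n => ?_) zero_le
  rw [← drawLaw_not_hasCompleteSets h0 h1]
  exact measure_mono fun ω hω hn => hω ⟨n, hn⟩

theorem lintegral_sum_range_collectTime {N : ℕ} {p : Fin N → ℝ} (hp : ∀ i, 0 < p i)
    (h1 : ∑ i, p i = 1) (m j : ℕ) :
    ∫⁻ ω, ∑ n ∈ Finset.range (collectTime m ω),
      ENNReal.ofReal ((j + n).factorial / n.factorial) ∂(drawLaw p)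
        = ENNReal.ofReal (tailMoment m j p) := by
  have h0 : ∀ i, 0 ≤ p i := fun i => (hp i).le
  rw [← tsum_incompleteProb hp h1]
  have e : ∀ᵐ ω ∂(drawLaw p), ∑ n ∈ Finset.range (collectTime m ω),
      ENNReal.ofReal ((j + n).factorial / n.factorial) =
      ∑' n : ℕ, {ω | ¬ HasCompleteSets m ω n}.indicator
        (fun _ => ENNReal.ofReal ((j + n).factorial / n.factorial)) ω := by
    filter_upwards [ae_exists_hasCompleteSets hp h1 m] with ω hω
    rw [tsum_eq_sum (s := Finset.range (collectTime m ω))]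
    · refine Finset.sum_congr rfl fun n hn => ?_
      rw [Set.indicator_of_mem]
      exact (lt_collectTime_iff hω n).1 (Finset.mem_range.1 hn)
    · intro n hn
      rw [Set.indicator_of_notMem]
      exact fun h => hn (Finset.mem_range.2 ((lt_collectTime_iff hω n).2 h))
  rw [lintegral_congr_ae e, lintegral_tsum]
  · refine tsum_congr fun n => ?_
    rw [← drawLaw_not_hasCompleteSets h0 h1]
    exact lintegral_indicator_const (measurableSet_hasCompleteSets m n).compl _
  · intro n
    exact (measurable_const.indicator (measurableSet_hasCompleteSets m n).compl).aemeasurable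

theorem lintegral_collectTime {N : ℕ} {p : Fin N → ℝ} (hp : ∀ i, 0 < p i)
    (h1 : ∑ i, p i = 1) (m : ℕ) :
    ∫⁻ ω, ENNReal.ofReal (collectTime m ω : ℝ) ∂(drawLaw p)
      = ENNReal.ofReal (tailMoment m 0 p) := by
  rw [← lintegral_sum_range_collectTime hp h1]
  refine lintegral_congr fun ω => ?_
  rw [← ENNReal.ofReal_sum_of_nonneg (fun n _ => by positivity)]
  congr 1
  have : ∀ n : ℕ, ((n.factorial : ℝ) / n.factorial) = 1 :=
    fun n => div_self (by exact_mod_cast n.factorial_ne_zero)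
  simp [this]

/-- For `j = 1` the weights are `n + 1`, and their sum over `n < T` is `T * (T + 1) / 2`. -/
theorem lintegral_collectTime_mul_succ {N : ℕ} {p : Fin N → ℝ} (hp : ∀ i, 0 < p i)
    (h1 : ∑ i, p i = 1) (m : ℕ) :
    ∫⁻ ω, ENNReal.ofReal ((collectTime m ω : ℝ) * (collectTime m ω + 1) / 2) ∂(drawLaw p)
      = ENNReal.ofReal (tailMoment m 1 p) := by
  rw [← lintegral_sum_range_collectTime hp h1]
  refine lintegral_congr fun ω => ?_
  rw [← ENNReal.ofReal_sum_of_nonneg (fun n _ => by positivity)]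
  congr 1
  generalize collectTime m ω = T
  induction T with
  | zero => simp
  | succ T ih =>
    have := T.factorial_ne_zero
    rw [Finset.sum_range_succ, ← ih, add_comm 1 T, Nat.factorial_succ]
    push_cast
    field_simp
    ring

theorem integrable_and_integral_of_lintegral {α : Type*} [MeasurableSpace α] {μ : Measure α}
    {f : α → ℝ} {c : ℝ} (hm : Measurable f) (hf : ∀ x, 0 ≤ f x) (hc : 0 ≤ c)
    (h : ∫⁻ x, ENNReal.ofReal (f x) ∂μ = ENNReal.ofReal c) :
    Integrable f μ ∧ ∫ x, f x ∂μ = c := by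
  constructor
  · refine ⟨hm.aestronglyMeasurable, ?_⟩
    rw [hasFiniteIntegral_iff_ofReal (Filter.Eventually.of_forall hf), h]
    exact ENNReal.ofReal_lt_top
  · rw [integral_eq_lintegral_of_nonneg_ae (Filter.Eventually.of_forall hf)
      hm.aestronglyMeasurable, h, ENNReal.toReal_ofReal hc]

theorem measurable_collectTime_real {N : ℕ} (m : ℕ) :
    Measurable (fun ω : ℕ → Fin N => (collectTime m ω : ℝ)) :=
  measurable_from_top.comp (measurable_collectTime m)

theorem collectTime_integrals {N : ℕ} {p : Fin N → ℝ} (hp : ∀ i, 0 < p i)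
    (h1 : ∑ i, p i = 1) (m : ℕ) :
    Integrable (fun ω => (collectTime m ω : ℝ) ^ 2) (drawLaw p) ∧
    ∫ ω, (collectTime m ω : ℝ) ∂(drawLaw p) = tailMoment m 0 p ∧
    ∫ ω, (collectTime m ω : ℝ) ^ 2 ∂(drawLaw p) = 2 * tailMoment m 1 p - tailMoment m 0 p := by
  have h0 : ∀ i, 0 ≤ p i := fun i => (hp i).le
  have hm := measurable_collectTime_real (N := N) m
  obtain ⟨i1, e1⟩ := integrable_and_integral_of_lintegral hm (fun ω => by positivity)
    (tailMoment_nonneg h0 h1 m 0) (lintegral_collectTime hp h1 m)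
  obtain ⟨i2, e2⟩ := integrable_and_integral_of_lintegral
    (f := fun ω => (collectTime m ω : ℝ) * (collectTime m ω + 1) / 2)
    (by fun_prop) (fun ω => by positivity)
    (tailMoment_nonneg h0 h1 m 1) (lintegral_collectTime_mul_succ hp h1 m)
  have e : (fun ω : ℕ → Fin N => (collectTime m ω : ℝ) ^ 2) = fun ω =>
      2 * ((collectTime m ω : ℝ) * (collectTime m ω + 1) / 2) - collectTime m ω := by
    funext ω
    ring
  refine ⟨?_, e1, ?_⟩
  · rw [e]
    exact (i2.const_mul 2).sub i1
  · rw [e, integral_sub (i2.const_mul 2) i1, integral_const_mul, e1, e2]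

theorem memLp_collectTime {N : ℕ} {p : Fin N → ℝ} (hp : ∀ i, 0 < p i)
    (h1 : ∑ i, p i = 1) (m : ℕ) :
    MemLp (fun ω : ℕ → Fin N => (collectTime m ω : ℝ)) 2 (drawLaw p) :=
  (memLp_two_iff_integrable_sq (measurable_collectTime_real m).aestronglyMeasurable).2
    (collectTime_integrals hp h1 m).1

theorem collectVar_eq {N : ℕ} {p : Fin N → ℝ} (hp : ∀ i, 0 < p i) (h1 : ∑ i, p i = 1) (m : ℕ) :
    collectVar m N p = 2 * tailMoment m 1 p - tailMoment m 0 p - tailMoment m 0 p ^ 2 := by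
  have := isProbabilityMeasure_drawLaw (fun i => (hp i).le) h1
  obtain ⟨-, e1, e2⟩ := collectTime_integrals hp h1 m
  rw [collectVar, variance_eq_sub (memLp_collectTime hp h1 m)]
  simp only [Pi.pow_apply]
  rw [e1, e2]

/-! ### Monotone ratios of the Erlang density, its distribution function and the primitive. -/

/-- The derivative of `poissonMass k`. -/
noncomputable def poissonMassDeriv (k : ℕ) (x : ℝ) : ℝ :=
  Real.exp (-x) * (k * x ^ (k - 1) / k.factorial - x ^ k / k.factorial)

theorem hasDerivAt_poissonMass (k : ℕ) (x : ℝ) :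
    HasDerivAt (poissonMass k) (poissonMassDeriv k x) x := by
  have h := ((hasDerivAt_neg x).exp).fun_mul ((hasDerivAt_pow k x).div_const (k.factorial : ℝ))
  refine h.congr_deriv ?_
  rw [poissonMassDeriv]
  ring

theorem continuous_poissonMassDeriv (k : ℕ) : Continuous (poissonMassDeriv k) := by
  unfold poissonMassDeriv
  fun_prop

theorem mul_poissonMassDeriv (k : ℕ) (x : ℝ) :
    x * poissonMassDeriv k x = (k - x) * poissonMass k x := by
  unfold poissonMassDeriv poissonMass
  cases k with
  | zero => simp
  | succ k =>
    rw [Nat.add_sub_cancel, pow_succ]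
    ring

theorem poissonMassDeriv_succ (k : ℕ) (x : ℝ) :
    poissonMassDeriv (k + 1) x = poissonMass k x - poissonMass (k + 1) x := by
  unfold poissonMassDeriv poissonMass
  rw [Nat.add_sub_cancel, Nat.factorial_succ]
  have := k.factorial_ne_zero
  push_cast
  field_simp

theorem poissonMass_pos (k : ℕ) {x : ℝ} (hx : 0 < x) : 0 < poissonMass k x := by
  unfold poissonMass
  positivity

/-- The derivatives of the Poisson masses telescope. -/
theorem hasDerivAt_erlangTail (n : ℕ) (x : ℝ) :
    HasDerivAt (erlangTail (n + 1)) (-poissonMass n x) x := by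
  induction n with
  | zero =>
    have e : erlangTail (0 + 1) = poissonMass 0 := by
      funext x
      simp [erlangTail]
    rw [e]
    refine (hasDerivAt_poissonMass 0 x).congr_deriv ?_
    simp [poissonMassDeriv, poissonMass]
  | succ n ih =>
    have e : erlangTail (n + 1 + 1) = fun x => erlangTail (n + 1) x + poissonMass (n + 1) x := by
      funext x
      simp [erlangTail, Finset.sum_range_succ]
    rw [e]
    refine (ih.fun_add (hasDerivAt_poissonMass (n + 1) x)).congr_deriv ?_
    rw [poissonMassDeriv_succ]
    ring

theorem hasDerivAt_erlangCDF (n : ℕ) (x : ℝ) :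
    HasDerivAt (erlangCDF (n + 1)) (poissonMass n x) x :=
  ((hasDerivAt_erlangTail n x).const_sub 1).congr_deriv (neg_neg _)

theorem continuous_erlangCDF (m : ℕ) : Continuous (erlangCDF m) :=
  continuous_const.sub (continuous_finsetSum _ fun k _ => continuous_poissonMass k)

theorem erlangCDF_nonneg (m : ℕ) {x : ℝ} (hx : 0 ≤ x) : 0 ≤ erlangCDF m x := by
  rw [← exp_mul_erlangCDF]
  exact mul_nonneg (Real.exp_pos _).le (sub_nonneg.2 (Real.sum_le_exp_of_nonneg hx m))

theorem erlangCDF_le_one (m : ℕ) {x : ℝ} (hx : 0 ≤ x) : erlangCDF m x ≤ 1 :=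
  sub_le_self _ (Finset.sum_nonneg fun k _ => poissonMass_nonneg k hx)

theorem erlangCDF_eq_add (m : ℕ) (x : ℝ) :
    erlangCDF m x = poissonMass m x + erlangCDF (m + 1) x := by
  simp only [erlangCDF, erlangTail, Finset.sum_range_succ]
  ring

theorem erlangCDF_pos (m : ℕ) {x : ℝ} (hx : 0 < x) : 0 < erlangCDF m x := by
  rw [erlangCDF_eq_add]
  exact add_pos_of_pos_of_nonneg (poissonMass_pos m hx) (erlangCDF_nonneg _ hx.le)

theorem poissonMass_le_one (k : ℕ) {x : ℝ} (hx : 0 ≤ x) : poissonMass k x ≤ 1 := by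
  have h1 := erlangCDF_le_one k hx
  have h2 := erlangCDF_nonneg (k + 1) hx
  rw [erlangCDF_eq_add] at h1
  linarith

theorem erlangCDF_succ_zero (n : ℕ) : erlangCDF (n + 1) 0 = 0 := by
  simp [erlangCDF, erlangTail, poissonMass, Finset.sum_range_succ']

/-- The antiderivative of `erlangCDF (n + 1)` that vanishes at `0`, in closed form. -/
noncomputable def erlangCDFPrimitive (n : ℕ) (x : ℝ) : ℝ :=
  x * erlangCDF (n + 1) x + x * poissonMass n x - (n + 1) * erlangCDF (n + 1) x

theorem hasDerivAt_erlangCDFPrimitive (n : ℕ) (x : ℝ) :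
    HasDerivAt (erlangCDFPrimitive n) (erlangCDF (n + 1) x) x := by
  have hF := hasDerivAt_erlangCDF n x
  refine ((((hasDerivAt_id x).fun_mul hF).fun_add ((hasDerivAt_id x).fun_mul
    (hasDerivAt_poissonMass n x))).fun_sub (hF.const_mul ((n : ℝ) + 1))).congr_deriv ?_
  have := mul_poissonMassDeriv n x
  simp only [id_eq]
  linear_combination this

theorem erlangCDFPrimitive_zero (n : ℕ) : erlangCDFPrimitive n 0 = 0 := by
  simp [erlangCDFPrimitive, erlangCDF_succ_zero]

theorem erlangCDFPrimitive_nonneg (n : ℕ) {x : ℝ} (hx : 0 ≤ x) : 0 ≤ erlangCDFPrimitive n x := by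
  have hd := hasDerivAt_erlangCDFPrimitive n
  have hmono : MonotoneOn (erlangCDFPrimitive n) (Set.Ici 0) := by
    refine monotoneOn_of_deriv_nonneg (convex_Ici 0)
      (fun y _ => (hd y).continuousAt.continuousWithinAt)
      (fun y _ => (hd y).differentiableAt.differentiableWithinAt) fun y hy => ?_
    rw [interior_Ici] at hy
    rw [(hd y).deriv]
    exact erlangCDF_nonneg _ (le_of_lt hy)
  have := hmono (Set.self_mem_Ici) hx hx
  rwa [erlangCDFPrimitive_zero] at this

/-- Substituting `x * f' = (n - x) * f` turns the sign of `f ^ 2 - F * f'` into that of `F + G`,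
where `G` is the primitive of `F`. The same identity later factors the curvature density. -/
theorem mul_sq_sub_erlangCDF_mul (n : ℕ) (x : ℝ) :
    x * (poissonMass n x ^ 2 - erlangCDF (n + 1) x * poissonMassDeriv n x)
      = poissonMass n x * (erlangCDF (n + 1) x + erlangCDFPrimitive n x) := by
  have := mul_poissonMassDeriv n x
  rw [erlangCDFPrimitive]
  linear_combination (-erlangCDF (n + 1) x) * this

theorem sq_sub_erlangCDF_mul_pos (n : ℕ) {x : ℝ} (hx : 0 < x) :
    0 < poissonMass n x ^ 2 - erlangCDF (n + 1) x * poissonMassDeriv n x := by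
  have h : 0 < x * (poissonMass n x ^ 2 - erlangCDF (n + 1) x * poissonMassDeriv n x) := by
    rw [mul_sq_sub_erlangCDF_mul]
    exact mul_pos (poissonMass_pos n hx)
      (add_pos_of_pos_of_nonneg (erlangCDF_pos _ hx) (erlangCDFPrimitive_nonneg n hx.le))
  exact pos_of_mul_pos_right h hx.le

theorem monotoneOn_erlangCDF_div_poissonMass (n : ℕ) :
    MonotoneOn (fun x => erlangCDF (n + 1) x / poissonMass n x) (Set.Ioi 0) := by
  have hd : ∀ x : ℝ, 0 < x → HasDerivAt (fun x => erlangCDF (n + 1) x / poissonMass n x) _ x :=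
    fun x hx => (hasDerivAt_erlangCDF n x).fun_div (hasDerivAt_poissonMass n x)
      (poissonMass_pos n hx).ne'
  refine monotoneOn_of_deriv_nonneg (convex_Ioi 0)
    (fun y hy => (hd y hy).continuousAt.continuousWithinAt) ?_ ?_
  · rw [interior_Ioi]
    exact fun y hy => (hd y hy).differentiableAt.differentiableWithinAt
  · rw [interior_Ioi]
    intro y hy
    rw [(hd y hy).deriv]
    refine div_nonneg ?_ (sq_nonneg _)
    have := sq_sub_erlangCDF_mul_pos n hy
    linarith

/-- Since `F / f` increases, `F s ≤ q * f s` for `0 < s ≤ x` with `q = F x / f x`; integrating over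
`[0, x]` gives `G x ≤ q * F x`. This is the sign condition for `G / F` to increase. -/
theorem erlangCDFPrimitive_mul_poissonMass_le (n : ℕ) {x : ℝ} (hx : 0 < x) :
    erlangCDFPrimitive n x * poissonMass n x ≤ erlangCDF (n + 1) x ^ 2 := by
  set q := erlangCDF (n + 1) x / poissonMass n x with hq
  have hd : ∀ s, HasDerivAt (fun s => q * erlangCDF (n + 1) s - erlangCDFPrimitive n s)
      (q * poissonMass n s - erlangCDF (n + 1) s) s := fun s =>
    ((hasDerivAt_erlangCDF n s).const_mul q).fun_sub (hasDerivAt_erlangCDFPrimitive n s)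
  have hmono : MonotoneOn (fun s => q * erlangCDF (n + 1) s - erlangCDFPrimitive n s)
      (Set.Icc 0 x) := by
    refine monotoneOn_of_deriv_nonneg (convex_Icc 0 x)
      (fun y _ => (hd y).continuousAt.continuousWithinAt)
      (fun y _ => (hd y).differentiableAt.differentiableWithinAt) fun y hy => ?_
    rw [interior_Icc] at hy
    rw [(hd y).deriv]
    have := monotoneOn_erlangCDF_div_poissonMass n (Set.mem_Ioi.2 hy.1) (Set.mem_Ioi.2 hx) hy.2.le
    exact sub_nonneg.2 ((div_le_iff₀ (poissonMass_pos n hy.1)).1 this)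
  have h := hmono (Set.left_mem_Icc.2 hx.le) (Set.right_mem_Icc.2 hx.le) hx.le
  simp only [erlangCDF_succ_zero, erlangCDFPrimitive_zero, mul_zero, sub_zero] at h
  have hw := poissonMass_pos n hx
  have := mul_le_mul_of_nonneg_right (sub_nonneg.1 h) hw.le
  refine this.trans_eq ?_
  rw [hq]
  field_simp

theorem monotoneOn_erlangCDFPrimitive_div (n : ℕ) :
    MonotoneOn (fun x => erlangCDFPrimitive n x / erlangCDF (n + 1) x) (Set.Ioi 0) := by
  have hd : ∀ x : ℝ, 0 < x →
      HasDerivAt (fun x => erlangCDFPrimitive n x / erlangCDF (n + 1) x) _ x :=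
    fun x hx => (hasDerivAt_erlangCDFPrimitive n x).fun_div (hasDerivAt_erlangCDF n x)
      (erlangCDF_pos _ hx).ne'
  refine monotoneOn_of_deriv_nonneg (convex_Ioi 0)
    (fun y hy => (hd y hy).continuousAt.continuousWithinAt) ?_ ?_
  · rw [interior_Ioi]
    exact fun y hy => (hd y hy).differentiableAt.differentiableWithinAt
  · rw [interior_Ioi]
    intro y hy
    rw [(hd y hy).deriv]
    refine div_nonneg ?_ (sq_nonneg _)
    have := erlangCDFPrimitive_mul_poissonMass_le n hy
    linarith

/-! ### Differentiating the tail moments twice along a line. -/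

/-- A bound on `poissonMass k (p * t)` for `p` in `[b, 3 * b]`. -/
noncomputable def poissonMassBound (k : ℕ) (b t : ℝ) : ℝ :=
  Real.exp (-(b * t)) * ((3 * b * t) ^ k / k.factorial)

/-- A bound on `|poissonMassDeriv k (p * t)|` for `p` in `[b, 3 * b]`. -/
noncomputable def poissonMassDerivBound (k : ℕ) (b t : ℝ) : ℝ :=
  Real.exp (-(b * t)) * (k * (3 * b * t) ^ (k - 1) / k.factorial + (3 * b * t) ^ k / k.factorial)

theorem poissonMass_le_bound (k : ℕ) {b p t : ℝ} (hb : 0 < b) (ht : 0 ≤ t)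
    (hp : p ∈ Set.Icc b (3 * b)) : poissonMass k (p * t) ≤ poissonMassBound k b t := by
  have hp0 : 0 ≤ p := hb.le.trans hp.1
  have h1 := hp.1
  have h2 := hp.2
  unfold poissonMass poissonMassBound
  gcongr

theorem abs_poissonMassDeriv_le_bound (k : ℕ) {b p t : ℝ} (hb : 0 < b) (ht : 0 ≤ t)
    (hp : p ∈ Set.Icc b (3 * b)) :
    |poissonMassDeriv k (p * t)| ≤ poissonMassDerivBound k b t := by
  have hp0 : 0 ≤ p := hb.le.trans hp.1
  have h1 := hp.1
  have h2 := hp.2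
  unfold poissonMassDeriv poissonMassDerivBound
  rw [abs_mul, abs_of_pos (Real.exp_pos _)]
  refine mul_le_mul (by gcongr) ((abs_sub _ _).trans ?_) (abs_nonneg _) (Real.exp_pos _).le
  rw [abs_of_nonneg (by positivity), abs_of_nonneg (by positivity)]
  gcongr

theorem integrableOn_pow_mul_poissonMassBound (j k : ℕ) {b : ℝ} (hb : 0 < b) :
    IntegrableOn (fun t => t ^ j * poissonMassBound k b t) (Set.Ioi 0) := by
  have e : (fun t => t ^ j * poissonMassBound k b t) = fun t =>
      ((3 * b) ^ k / k.factorial) * (t ^ (j + k) * Real.exp (-(b * t))) := by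
    funext t
    rw [poissonMassBound, mul_pow, pow_add]
    ring
  rw [e]
  exact (integrableOn_pow_mul_exp_neg_mul _ hb).const_mul _

theorem integrableOn_pow_mul_poissonMassDerivBound (j k : ℕ) {b : ℝ} (hb : 0 < b) :
    IntegrableOn (fun t => t ^ j * poissonMassDerivBound k b t) (Set.Ioi 0) := by
  have e : (fun t => t ^ j * poissonMassDerivBound k b t) = fun t =>
      (k * (3 * b) ^ (k - 1) / k.factorial) * (t ^ (j + (k - 1)) * Real.exp (-(b * t))) +
      ((3 * b) ^ k / k.factorial) * (t ^ (j + k) * Real.exp (-(b * t))) := by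
    funext t
    rw [poissonMassDerivBound, mul_pow, mul_pow, pow_add, pow_add]
    ring
  rw [e]
  exact ((integrableOn_pow_mul_exp_neg_mul _ hb).const_mul _).add
    ((integrableOn_pow_mul_exp_neg_mul _ hb).const_mul _)

/-- The derivative of `∏ i, erlangCDF (n + 1) (p i * t)` as `p` moves in the direction `h`. -/
noncomputable def prodCDFDeriv {N : ℕ} (n : ℕ) (h p : Fin N → ℝ) (t : ℝ) : ℝ :=
  ∑ i, (∏ j ∈ Finset.univ.erase i, erlangCDF (n + 1) (p j * t)) *
    (poissonMass n (p i * t) * (h i * t))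

/-- The second derivative of `∏ i, erlangCDF (n + 1) (p i * t)` as `p` moves in the
direction `h`. -/
noncomputable def prodCDFDeriv₂ {N : ℕ} (n : ℕ) (h p : Fin N → ℝ) (t : ℝ) : ℝ :=
  ∑ i, ((∑ k ∈ Finset.univ.erase i,
      (∏ j ∈ (Finset.univ.erase i).erase k, erlangCDF (n + 1) (p j * t)) *
        (poissonMass n (p k * t) * (h k * t))) * (poissonMass n (p i * t) * (h i * t)) +
    (∏ j ∈ Finset.univ.erase i, erlangCDF (n + 1) (p j * t)) *
      (poissonMassDeriv n (p i * t) * (h i * t) * (h i * t)))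

theorem hasDerivAt_line_mul {N : ℕ} (u h : Fin N → ℝ) (t s : ℝ) (i : Fin N) :
    HasDerivAt (fun s : ℝ => (u + s • h) i * t) (h i * t) s := by
  have := (((hasDerivAt_id s).mul_const (h i)).const_add (u i)).mul_const t
  simpa using this

theorem hasDerivAt_prodCDF {N : ℕ} (n : ℕ) (u h : Fin N → ℝ) (t s : ℝ) :
    HasDerivAt (fun s : ℝ => ∏ i, erlangCDF (n + 1) ((u + s • h) i * t))
      (prodCDFDeriv n h (u + s • h) t) s :=
  HasDerivAt.fun_finsetProd fun i _ =>
    (hasDerivAt_erlangCDF n _).comp s (hasDerivAt_line_mul u h t s i)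

theorem hasDerivAt_prodCDFDeriv {N : ℕ} (n : ℕ) (u h : Fin N → ℝ) (t s : ℝ) :
    HasDerivAt (fun s : ℝ => prodCDFDeriv n h (u + s • h) t)
      (prodCDFDeriv₂ n h (u + s • h) t) s := by
  refine HasDerivAt.fun_sum fun i _ => HasDerivAt.fun_mul ?_ ?_
  · exact HasDerivAt.fun_finsetProd fun k _ =>
      (hasDerivAt_erlangCDF n _).comp s (hasDerivAt_line_mul u h t s k)
  · exact ((hasDerivAt_poissonMass n _).comp s (hasDerivAt_line_mul u h t s i)).mul_const _

theorem abs_prod_erlangCDF_le_one {N : ℕ} (m : ℕ) {p : Fin N → ℝ} (hp : ∀ i, 0 ≤ p i) {t : ℝ}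
    (ht : 0 ≤ t) (J : Finset (Fin N)) : |∏ j ∈ J, erlangCDF m (p j * t)| ≤ 1 := by
  have h0 : ∀ j, 0 ≤ p j * t := fun j => mul_nonneg (hp j) ht
  rw [abs_of_nonneg (Finset.prod_nonneg fun j _ => erlangCDF_nonneg m (h0 j))]
  exact Finset.prod_le_one (fun j _ => erlangCDF_nonneg m (h0 j))
    fun j _ => erlangCDF_le_one m (h0 j)

theorem abs_prodCDFDeriv_le {N : ℕ} (n : ℕ) (h : Fin N → ℝ) {p : Fin N → ℝ} {b t : ℝ}
    (hb : 0 < b) (ht : 0 ≤ t) (hp : ∀ i, p i ∈ Set.Icc b (3 * b)) :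
    |prodCDFDeriv n h p t| ≤ (∑ i, |h i|) * (t * poissonMassBound n b t) := by
  have hp0 : ∀ i, 0 ≤ p i := fun i => hb.le.trans (hp i).1
  rw [prodCDFDeriv, Finset.sum_mul]
  refine (Finset.abs_sum_le_sum_abs _ _).trans (Finset.sum_le_sum fun i _ => ?_)
  rw [abs_mul, abs_mul, abs_mul, abs_of_nonneg ht,
    abs_of_nonneg (poissonMass_nonneg n (mul_nonneg (hp0 i) ht))]
  calc _ ≤ 1 * (poissonMassBound n b t * (|h i| * t)) := by
        gcongr
        · exact mul_nonneg (poissonMass_nonneg n (mul_nonneg (hp0 i) ht)) (by positivity)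
        · exact abs_prod_erlangCDF_le_one _ hp0 ht _
        · exact poissonMass_le_bound n hb ht (hp i)
    _ = _ := by ring

theorem abs_prodCDFDeriv₂_le {N : ℕ} (n : ℕ) (h : Fin N → ℝ) {p : Fin N → ℝ} {b t : ℝ}
    (hb : 0 < b) (ht : 0 ≤ t) (hp : ∀ i, p i ∈ Set.Icc b (3 * b)) :
    |prodCDFDeriv₂ n h p t| ≤ (∑ i, (∑ k ∈ Finset.univ.erase i, |h k|) * |h i|) *
        (t ^ 2 * poissonMassBound n b t) +
      (∑ i, |h i| ^ 2) * (t ^ 2 * poissonMassDerivBound n b t) := by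
  have hp0 : ∀ i, 0 ≤ p i := fun i => hb.le.trans (hp i).1
  have hw : ∀ i, 0 ≤ poissonMass n (p i * t) :=
    fun i => poissonMass_nonneg n (mul_nonneg (hp0 i) ht)
  rw [prodCDFDeriv₂, Finset.sum_mul, Finset.sum_mul, ← Finset.sum_add_distrib]
  refine (Finset.abs_sum_le_sum_abs _ _).trans (Finset.sum_le_sum fun i _ => ?_)
  refine (abs_add_le _ _).trans (add_le_add ?_ ?_)
  · have hs : |∑ k ∈ Finset.univ.erase i,
        (∏ j ∈ (Finset.univ.erase i).erase k, erlangCDF (n + 1) (p j * t)) *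
        (poissonMass n (p k * t) * (h k * t))| ≤ ∑ k ∈ Finset.univ.erase i, |h k| * t := by
      refine (Finset.abs_sum_le_sum_abs _ _).trans (Finset.sum_le_sum fun k _ => ?_)
      rw [abs_mul, abs_mul, abs_mul, abs_of_nonneg ht, abs_of_nonneg (hw k)]
      -- Of the two density factors, this one is bounded by `1`; the other keeps the exponential
      -- decay needed for integrability.
      calc _ ≤ 1 * (1 * (|h k| * t)) := by
            gcongr
            · exact mul_nonneg (hw k) (by positivity)
            · exact abs_prod_erlangCDF_le_one _ hp0 ht _
            · exact poissonMass_le_one n (mul_nonneg (hp0 k) ht)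
        _ = _ := by ring
    rw [abs_mul, abs_mul, abs_mul, abs_of_nonneg ht, abs_of_nonneg (hw i)]
    rw [← Finset.sum_mul] at hs
    calc _ ≤ ((∑ k ∈ Finset.univ.erase i, |h k|) * t) *
          (poissonMassBound n b t * (|h i| * t)) := by
          refine mul_le_mul hs ?_ (mul_nonneg (hw i) (by positivity)) (by positivity)
          gcongr
          exact poissonMass_le_bound n hb ht (hp i)
      _ = _ := by ring
  · rw [abs_mul, abs_mul, abs_mul, abs_mul, abs_of_nonneg ht]
    calc _ ≤ 1 * (poissonMassDerivBound n b t * (|h i| * t) * (|h i| * t)) := by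
          refine mul_le_mul (abs_prod_erlangCDF_le_one _ hp0 ht _) ?_ (by positivity) zero_le_one
          gcongr
          exact abs_poissonMassDeriv_le_bound n hb ht (hp i)
      _ = _ := by ring

theorem continuous_prodCDFDeriv {N : ℕ} (n : ℕ) (h p : Fin N → ℝ) :
    Continuous (prodCDFDeriv n h p) := by
  have h1 := continuous_erlangCDF (n + 1)
  have h2 := continuous_poissonMass n
  unfold prodCDFDeriv
  fun_prop

theorem continuous_prodCDFDeriv₂ {N : ℕ} (n : ℕ) (h p : Fin N → ℝ) :
    Continuous (prodCDFDeriv₂ n h p) := by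
  have h1 := continuous_erlangCDF (n + 1)
  have h2 := continuous_poissonMass n
  have h3 := continuous_poissonMassDeriv n
  unfold prodCDFDeriv₂
  fun_prop

theorem continuous_poissonTail {N : ℕ} (m : ℕ) (p : Fin N → ℝ) :
    Continuous (poissonTail m p) := by
  have h1 := continuous_erlangCDF m
  unfold poissonTail
  fun_prop

theorem eventually_line_mem_Ioo {N : ℕ} (u h : Fin N → ℝ) {a b : ℝ}
    (hu : ∀ i, u i ∈ Set.Ioo a b) :
    ∃ S : Set ℝ, IsOpen S ∧ (0 : ℝ) ∈ S ∧ ∀ s ∈ S, ∀ i, (u + s • h) i ∈ Set.Ioo a b := by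
  have hev : ∀ᶠ s in nhds (0 : ℝ), ∀ i, (u + s • h) i ∈ Set.Ioo a b := by
    refine Filter.eventually_all.2 fun i => ?_
    have hc : ContinuousAt (fun s : ℝ => (u + s • h) i) 0 := by
      simp only [Pi.add_apply, Pi.smul_apply, smul_eq_mul]
      fun_prop
    refine hc.eventually_mem (isOpen_Ioo.mem_nhds ?_)
    simpa using hu i
  obtain ⟨S, hS, hSo, h0S⟩ := eventually_nhds_iff.1 hev
  exact ⟨S, hSo, h0S, hS⟩

theorem aestronglyMeasurable_pow_mul_prodCDFDeriv {N : ℕ} (n j : ℕ) (h p : Fin N → ℝ) :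
    AEStronglyMeasurable (fun t => t ^ j * prodCDFDeriv n h p t) (volume.restrict (Set.Ioi 0)) :=
  ((continuous_pow j).mul (continuous_prodCDFDeriv n h p)).aestronglyMeasurable

theorem hasDerivAt_tailMoment_line {N : ℕ} (n j : ℕ) (u h : Fin N → ℝ) {b : ℝ} (hb : 0 < b)
    {S : Set ℝ} (hSo : IsOpen S) (hS : ∀ s ∈ S, ∀ i, (u + s • h) i ∈ Set.Ioo b (3 * b))
    {s : ℝ} (hs : s ∈ S) :
    IntegrableOn (fun t => t ^ j * prodCDFDeriv n h (u + s • h) t) (Set.Ioi 0) ∧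
      HasDerivAt (fun s : ℝ => tailMoment (n + 1) j (u + s • h))
      (∫ t in Set.Ioi (0 : ℝ), -(t ^ j * prodCDFDeriv n h (u + s • h) t)) s := by
  have hint : IntegrableOn (fun t => (∑ i, |h i|) * (t ^ (j + 1) * poissonMassBound n b t))
      (Set.Ioi 0) := (integrableOn_pow_mul_poissonMassBound (j + 1) n hb).const_mul _
  have hbound : ∀ᵐ t ∂(volume.restrict (Set.Ioi (0 : ℝ))), ∀ s ∈ S,
      ‖-(t ^ j * prodCDFDeriv n h (u + s • h) t)‖ ≤
        (∑ i, |h i|) * (t ^ (j + 1) * poissonMassBound n b t) := by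
    filter_upwards [ae_restrict_mem measurableSet_Ioi] with t ht s hs
    have ht : 0 ≤ t := le_of_lt ht
    rw [Real.norm_eq_abs, abs_neg, abs_mul, abs_of_nonneg (pow_nonneg ht j), pow_succ]
    have := mul_le_mul_of_nonneg_left (abs_prodCDFDeriv_le n h hb ht
      fun i => Set.Ioo_subset_Icc_self (hS s hs i)) (pow_nonneg ht j)
    linarith
  have hderiv : ∀ᵐ t ∂(volume.restrict (Set.Ioi (0 : ℝ))), ∀ s ∈ S,
      HasDerivAt (fun s : ℝ => t ^ j * poissonTail (n + 1) (u + s • h) t)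
        (-(t ^ j * prodCDFDeriv n h (u + s • h) t)) s :=
    Filter.Eventually.of_forall fun t s _ =>
      (((hasDerivAt_prodCDF n u h t s).const_sub 1).const_mul (t ^ j)).congr_deriv (mul_neg _ _)
  have hmeas : ∀ᶠ s in nhds s, AEStronglyMeasurable
      (fun t => t ^ j * poissonTail (n + 1) (u + s • h) t) (volume.restrict (Set.Ioi (0 : ℝ))) :=
    Filter.Eventually.of_forall fun s =>
      ((continuous_pow j).mul (continuous_poissonTail _ _)).aestronglyMeasurable
  have := hasDerivAt_integral_of_dominated_loc_of_deriv_le (hSo.mem_nhds hs) hmeas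
    (integrableOn_pow_mul_poissonTail (n + 1) j fun i => hb.trans (hS s hs i).1)
    (aestronglyMeasurable_pow_mul_prodCDFDeriv n j h _).neg hbound hint hderiv
  exact ⟨by simpa [IntegrableOn] using this.1.neg, this.2⟩

theorem hasDerivAt_integral_prodCDFDeriv_line {N : ℕ} (n j : ℕ) (u h : Fin N → ℝ) {b : ℝ}
    (hb : 0 < b) {S : Set ℝ} (hSo : IsOpen S)
    (hS : ∀ s ∈ S, ∀ i, (u + s • h) i ∈ Set.Ioo b (3 * b)) {s : ℝ} (hs : s ∈ S) :
    HasDerivAt (fun s : ℝ => ∫ t in Set.Ioi (0 : ℝ), -(t ^ j * prodCDFDeriv n h (u + s • h) t))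
      (∫ t in Set.Ioi (0 : ℝ), -(t ^ j * prodCDFDeriv₂ n h (u + s • h) t)) s := by
  have hint : IntegrableOn (fun t => (∑ i, (∑ k ∈ Finset.univ.erase i, |h k|) * |h i|) *
        (t ^ (j + 2) * poissonMassBound n b t) +
        (∑ i, |h i| ^ 2) * (t ^ (j + 2) * poissonMassDerivBound n b t)) (Set.Ioi 0) :=
    ((integrableOn_pow_mul_poissonMassBound (j + 2) n hb).const_mul _).add
      ((integrableOn_pow_mul_poissonMassDerivBound (j + 2) n hb).const_mul _)
  have hbound : ∀ᵐ t ∂(volume.restrict (Set.Ioi (0 : ℝ))), ∀ s ∈ S,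
      ‖-(t ^ j * prodCDFDeriv₂ n h (u + s • h) t)‖ ≤
        (∑ i, (∑ k ∈ Finset.univ.erase i, |h k|) * |h i|) *
        (t ^ (j + 2) * poissonMassBound n b t) +
        (∑ i, |h i| ^ 2) * (t ^ (j + 2) * poissonMassDerivBound n b t) := by
    filter_upwards [ae_restrict_mem measurableSet_Ioi] with t ht s hs
    have ht : 0 ≤ t := le_of_lt ht
    rw [Real.norm_eq_abs, abs_neg, abs_mul, abs_of_nonneg (pow_nonneg ht j), pow_add]
    have := mul_le_mul_of_nonneg_left (abs_prodCDFDeriv₂_le n h hb ht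
      fun i => Set.Ioo_subset_Icc_self (hS s hs i)) (pow_nonneg ht j)
    linarith
  have hderiv : ∀ᵐ t ∂(volume.restrict (Set.Ioi (0 : ℝ))), ∀ s ∈ S,
      HasDerivAt (fun s : ℝ => -(t ^ j * prodCDFDeriv n h (u + s • h) t))
        (-(t ^ j * prodCDFDeriv₂ n h (u + s • h) t)) s :=
    Filter.Eventually.of_forall fun t s _ =>
      ((hasDerivAt_prodCDFDeriv n u h t s).const_mul (t ^ j)).fun_neg
  have hmeas : ∀ᶠ s in nhds s, AEStronglyMeasurable
      (fun t => -(t ^ j * prodCDFDeriv n h (u + s • h) t)) (volume.restrict (Set.Ioi (0 : ℝ))) :=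
    Filter.Eventually.of_forall fun s => (aestronglyMeasurable_pow_mul_prodCDFDeriv n j h _).neg
  have hmeas' : AEStronglyMeasurable (fun t => -(t ^ j * prodCDFDeriv₂ n h (u + s • h) t))
      (volume.restrict (Set.Ioi (0 : ℝ))) :=
    ((continuous_pow j).mul (continuous_prodCDFDeriv₂ n h _)).neg.aestronglyMeasurable
  have hint₀ : Integrable (fun t => -(t ^ j * prodCDFDeriv n h (u + s • h) t))
      (volume.restrict (Set.Ioi (0 : ℝ))) :=
    (hasDerivAt_tailMoment_line n j u h hb hSo hS hs).1.neg
  have := hasDerivAt_integral_of_dominated_loc_of_deriv_le (hSo.mem_nhds hs) hmeas hint₀ hmeas'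
    hbound hint hderiv
  exact this.2

/-! ### Derivatives and densities at the uniform vector. -/

/-- The density at `t` of the completion time of the Poissonized uniform collection. -/
noncomputable def maxDensity (n N : ℕ) (t : ℝ) : ℝ :=
  erlangCDF (n + 1) (1 / N * t) ^ (N - 1) * poissonMass n (1 / N * t)

/-- The second derivative of `poissonTail` at the uniform vector, in a tangent direction of
norm one. -/
noncomputable def curvatureDensity (n N : ℕ) (t : ℝ) : ℝ :=
  t ^ 2 * (erlangCDF (n + 1) (1 / N * t) ^ (N - 2) *
    (poissonMass n (1 / N * t) ^ 2
      - erlangCDF (n + 1) (1 / N * t) * poissonMassDeriv n (1 / N * t)))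

theorem prodCDFDeriv_uniformVec {N : ℕ} (n : ℕ) {h : Fin N → ℝ} (hh : ∑ i, h i = 0) (t : ℝ) :
    prodCDFDeriv n h (uniformVec N) t = 0 := by
  simp only [prodCDFDeriv, uniformVec, Finset.prod_const,
    Finset.card_erase_of_mem (Finset.mem_univ _)]
  rw [← Finset.mul_sum, ← Finset.mul_sum, ← Finset.sum_mul, hh]
  ring

/-- At equal rates the mixed terms share one coefficient, and `∑ k ≠ i, h k = -h i` turns them into
multiples of `h i ^ 2`, to be merged with the diagonal terms. -/
theorem prodCDFDeriv₂_uniformVec {N : ℕ} (hN : 2 ≤ N) (n : ℕ) {h : Fin N → ℝ}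
    (hh : ∑ i, h i = 0) (t : ℝ) :
    prodCDFDeriv₂ n h (uniformVec N) t = -((∑ i, h i ^ 2) * curvatureDensity n N t) := by
  have hinner : ∀ i, ∑ k ∈ Finset.univ.erase i,
      (∏ j ∈ (Finset.univ.erase i).erase k, erlangCDF (n + 1) (uniformVec N j * t)) *
        (poissonMass n (uniformVec N k * t) * (h k * t))
      = erlangCDF (n + 1) (1 / N * t) ^ (N - 2) * (poissonMass n (1 / N * t) * (-h i * t)) := by
    intro i
    have hs : ∑ k ∈ Finset.univ.erase i, h k = -h i := by
      rw [← Finset.add_sum_erase _ _ (Finset.mem_univ i)] at hh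
      linarith
    rw [← hs, Finset.sum_mul, Finset.mul_sum, Finset.mul_sum]
    refine Finset.sum_congr rfl fun k hk => ?_
    simp only [uniformVec, Finset.prod_const]
    rw [Finset.card_erase_of_mem hk, Finset.card_erase_of_mem (Finset.mem_univ i),
      Finset.card_univ, Fintype.card_fin, Nat.sub_sub]
  have hpow : erlangCDF (n + 1) (1 / N * t) ^ (N - 1)
      = erlangCDF (n + 1) (1 / N * t) ^ (N - 2) * erlangCDF (n + 1) (1 / N * t) := by
    rw [← pow_succ]
    congr 1
    omega
  simp only [prodCDFDeriv₂, hinner]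
  simp only [uniformVec, Finset.prod_const, Finset.card_erase_of_mem (Finset.mem_univ _),
    Finset.card_univ, Fintype.card_fin, hpow]
  rw [Finset.sum_mul, ← Finset.sum_neg_distrib]
  refine Finset.sum_congr rfl fun i _ => ?_
  rw [curvatureDensity]
  ring

/-- With `b = 1 / (2 * N)` the uniform rate is `2 * b`, inside the window where the dominating
bounds hold. -/
theorem one_div_mem_Ioo {N : ℕ} (hN : 0 < N) :
    (1 / N : ℝ) ∈ Set.Ioo (1 / (2 * N) : ℝ) (3 * (1 / (2 * N))) := by
  have hN' : (0 : ℝ) < N := Nat.cast_pos.2 hN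
  constructor
  · rw [div_lt_div_iff₀ (by positivity) hN']
    linarith
  · rw [← mul_div_assoc, div_lt_div_iff₀ hN' (by positivity)]
    linarith

theorem continuous_maxDensity (n N : ℕ) : Continuous (maxDensity n N) := by
  have h1 := continuous_erlangCDF (n + 1)
  have h2 := continuous_poissonMass n
  unfold maxDensity
  fun_prop

theorem continuous_curvatureDensity (n N : ℕ) : Continuous (curvatureDensity n N) := by
  have h1 := continuous_erlangCDF (n + 1)
  have h2 := continuous_poissonMass n
  have h3 := continuous_poissonMassDeriv n
  unfold curvatureDensity
  fun_prop

theorem maxDensity_pos (n : ℕ) {N : ℕ} (hN : 0 < N) {t : ℝ} (ht : 0 < t) :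
    0 < maxDensity n N t := by
  have hx : 0 < 1 / (N : ℝ) * t := by positivity
  exact mul_pos (pow_pos (erlangCDF_pos _ hx) _) (poissonMass_pos n hx)

theorem curvatureDensity_pos (n : ℕ) {N : ℕ} (hN : 0 < N) {t : ℝ} (ht : 0 < t) :
    0 < curvatureDensity n N t := by
  have hx : 0 < 1 / (N : ℝ) * t := by positivity
  exact mul_pos (pow_pos ht 2) (mul_pos (pow_pos (erlangCDF_pos _ hx) _)
    (sq_sub_erlangCDF_mul_pos n hx))

theorem integrableOn_pow_mul_maxDensity (n j : ℕ) {N : ℕ} (hN : 0 < N) :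
    IntegrableOn (fun t => t ^ j * maxDensity n N t) (Set.Ioi 0) := by
  have hb : (0 : ℝ) < 1 / (2 * N) := by positivity
  refine (integrableOn_pow_mul_poissonMassBound j n hb).mono'
    ((continuous_pow j).mul (continuous_maxDensity n N)).aestronglyMeasurable ?_
  filter_upwards [ae_restrict_mem measurableSet_Ioi] with t ht
  have ht : 0 < t := ht
  have hx : 0 ≤ 1 / (N : ℝ) * t := by positivity
  rw [Real.norm_eq_abs, abs_of_nonneg (mul_nonneg (pow_nonneg ht.le j) (maxDensity_pos n hN ht).le)]
  refine mul_le_mul_of_nonneg_left ?_ (pow_nonneg ht.le j)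
  refine (mul_le_of_le_one_left (poissonMass_nonneg n hx)
    (pow_le_one₀ (erlangCDF_nonneg _ hx) (erlangCDF_le_one _ hx))).trans ?_
  exact poissonMass_le_bound n hb ht.le (Set.Ioo_subset_Icc_self (one_div_mem_Ioo hN))

theorem integrableOn_pow_mul_curvatureDensity (n j : ℕ) {N : ℕ} (hN : 0 < N) :
    IntegrableOn (fun t => t ^ j * curvatureDensity n N t) (Set.Ioi 0) := by
  have hb : (0 : ℝ) < 1 / (2 * N) := by positivity
  refine ((integrableOn_pow_mul_poissonMassBound (j + 2) n hb).add
    (integrableOn_pow_mul_poissonMassDerivBound (j + 2) n hb)).mono'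
    ((continuous_pow j).mul (continuous_curvatureDensity n N)).aestronglyMeasurable ?_
  filter_upwards [ae_restrict_mem measurableSet_Ioi] with t ht
  have ht : 0 < t := ht
  have hx : 0 ≤ 1 / (N : ℝ) * t := by positivity
  have hmem := Set.Ioo_subset_Icc_self (one_div_mem_Ioo hN)
  rw [Real.norm_eq_abs, abs_of_nonneg
    (mul_nonneg (pow_nonneg ht.le j) (curvatureDensity_pos n hN ht).le)]
  simp only [Pi.add_apply, curvatureDensity]
  rw [← mul_assoc, ← pow_add, ← mul_add]
  refine mul_le_mul_of_nonneg_left ?_ (pow_nonneg ht.le _)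
  have hF0 := erlangCDF_nonneg (n + 1) hx
  have hF1 := erlangCDF_le_one (n + 1) hx
  have hw0 := poissonMass_nonneg n hx
  have hw1 := poissonMass_le_one n hx
  have hw := poissonMass_le_bound n hb ht.le hmem
  have hd := abs_poissonMassDeriv_le_bound n hb ht.le hmem
  have hpos := (sq_sub_erlangCDF_mul_pos n (x := 1 / (N : ℝ) * t) (by positivity)).le
  refine (mul_le_of_le_one_left hpos (pow_le_one₀ hF0 hF1)).trans ?_
  have h1 : poissonMass n (1 / N * t) ^ 2 ≤ poissonMass n (1 / N * t) :=
    pow_le_of_le_one hw0 hw1 two_ne_zero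
  have h2 : -(erlangCDF (n + 1) (1 / N * t) * poissonMassDeriv n (1 / N * t))
      ≤ |poissonMassDeriv n (1 / N * t)| := by
    refine (neg_le_abs _).trans ?_
    rw [abs_mul, abs_of_nonneg hF0]
    exact mul_le_of_le_one_left (abs_nonneg _) hF1
  linarith

theorem setIntegral_Ioi_pos {f : ℝ → ℝ} (hf : IntegrableOn f (Set.Ioi 0))
    (hpos : ∀ t, 0 < t → 0 < f t) : 0 < ∫ t in Set.Ioi (0 : ℝ), f t := by
  rw [setIntegral_pos_iff_support_of_nonneg_ae _ hf]
  · have : Function.support f ∩ Set.Ioi 0 = Set.Ioi 0 :=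
      Set.inter_eq_right.2 fun t ht => (hpos t ht).ne'
    rw [this, Real.volume_Ioi]
    exact ENNReal.coe_lt_top
  · filter_upwards [ae_restrict_mem measurableSet_Ioi] with t ht
    exact (hpos t ht).le

theorem uniformVec_pos {N : ℕ} (hN : 0 < N) (i : Fin N) : 0 < uniformVec N i := by
  have : (0 : ℝ) < N := Nat.cast_pos.2 hN
  exact one_div_pos.2 this

theorem sum_uniformVec {N : ℕ} (hN : 0 < N) : ∑ i, uniformVec N i = 1 := by
  have : (N : ℝ) ≠ 0 := Nat.cast_ne_zero.2 hN.ne'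
  simp [uniformVec, this]

theorem hasDerivAt_poissonTail_uniformVec (n : ℕ) {N : ℕ} (hN : 0 < N) (t : ℝ) :
    HasDerivAt (poissonTail (n + 1) (uniformVec N)) (-maxDensity n N t) t := by
  have e : poissonTail (n + 1) (uniformVec N) = fun t => 1 - erlangCDF (n + 1) (1 / N * t) ^ N := by
    funext t
    simp [poissonTail, uniformVec]
  rw [e]
  have h1 : HasDerivAt (fun t : ℝ => 1 / (N : ℝ) * t) (1 / N) t := by
    simpa using (hasDerivAt_id t).const_mul (1 / (N : ℝ))
  have h2 := (((hasDerivAt_erlangCDF n _).comp t h1).fun_pow N).const_sub 1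
  refine h2.congr_deriv ?_
  have : (N : ℝ) ≠ 0 := Nat.cast_ne_zero.2 hN.ne'
  simp only [Function.comp_apply, maxDensity]
  field_simp

/-- Integration by parts. The boundary term at infinity vanishes because `t ^ (j + 1)` times the
tail and its derivative are both integrable. -/
theorem succ_mul_tailMoment_uniformVec (n j : ℕ) {N : ℕ} (hN : 0 < N) :
    (j + 1) * tailMoment (n + 1) j (uniformVec N)
      = ∫ t in Set.Ioi (0 : ℝ), t ^ (j + 1) * maxDensity n N t := by
  have hd : ∀ t ∈ Set.Ioi (0 : ℝ), HasDerivAt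
      (fun t => t ^ (j + 1) * poissonTail (n + 1) (uniformVec N) t)
      (((j : ℝ) + 1) * (t ^ j * poissonTail (n + 1) (uniformVec N) t)
        - t ^ (j + 1) * maxDensity n N t) t := fun t _ => by
    refine ((hasDerivAt_pow (j + 1) t).fun_mul
      (hasDerivAt_poissonTail_uniformVec n hN t)).congr_deriv ?_
    rw [Nat.add_sub_cancel]
    push_cast
    ring
  have hi : ∀ k, IntegrableOn (fun t => t ^ k * poissonTail (n + 1) (uniformVec N) t) (Set.Ioi 0) :=
    fun k => integrableOn_pow_mul_poissonTail (n + 1) k (uniformVec_pos hN)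
  have hi1 := (hi j).const_mul ((j : ℝ) + 1)
  have hi2 := integrableOn_pow_mul_maxDensity n (j + 1) hN
  have hi' : IntegrableOn (fun t => ((j : ℝ) + 1) * (t ^ j * poissonTail (n + 1) (uniformVec N) t)
        - t ^ (j + 1) * maxDensity n N t) (Set.Ioi 0) := hi1.sub hi2
  have hlim := tendsto_zero_of_hasDerivAt_of_integrableOn_Ioi hd hi' (hi (j + 1))
  have h := integral_Ioi_of_hasDerivAt_of_tendsto
    ((continuous_pow (j + 1)).mul (continuous_poissonTail (n + 1)
      (uniformVec N))).continuousAt.continuousWithinAt hd hi' hlim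
  rw [integral_sub hi1 hi2, integral_const_mul] at h
  change _ = 0 - (0 : ℝ) ^ (j + 1) * poissonTail (n + 1) (uniformVec N) 0 at h
  rw [zero_pow j.succ_ne_zero, zero_mul, sub_zero] at h
  rw [tailMoment]
  linarith

/-! ### The comparison of means and positivity of the constant. -/

theorem curvatureDensity_eq (n : ℕ) {N : ℕ} (hN : 2 ≤ N) {t : ℝ} (ht : 0 < t) :
    curvatureDensity n N t = N * (t * maxDensity n N t) *
      (1 + erlangCDFPrimitive n (1 / N * t) / erlangCDF (n + 1) (1 / N * t)) := by
  have hN' : (0 : ℝ) < N := Nat.cast_pos.2 (by omega)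
  have hx : 0 < 1 / (N : ℝ) * t := by positivity
  have ht' : t = N * (1 / N * t) := by field_simp
  have hF := erlangCDF_pos (n + 1) hx
  have key := mul_sq_sub_erlangCDF_mul n (1 / N * t)
  have hpow : erlangCDF (n + 1) (1 / N * t) ^ (N - 1)
      = erlangCDF (n + 1) (1 / N * t) ^ (N - 2) * erlangCDF (n + 1) (1 / N * t) := by
    rw [← pow_succ]
    congr 1
    omega
  rw [curvatureDensity, maxDensity, hpow]
  generalize 1 / (N : ℝ) * t = x at *
  have hdiv : 1 + erlangCDFPrimitive n x / erlangCDF (n + 1) x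
      = (erlangCDF (n + 1) x + erlangCDFPrimitive n x) / erlangCDF (n + 1) x := by
    rw [add_div, div_self hF.ne']
  rw [hdiv]
  calc _ = t * N * erlangCDF (n + 1) x ^ (N - 2) *
        (x * (poissonMass n x ^ 2 - erlangCDF (n + 1) x * poissonMassDeriv n x)) := by
        linear_combination (t * (erlangCDF (n + 1) x ^ (N - 2) *
          (poissonMass n x ^ 2 - erlangCDF (n + 1) x * poissonMassDeriv n x))) * ht'
    _ = _ := by
        rw [key]
        field_simp

/-- The mean of `t` under the weight `curvatureDensity` is at least its mean under the weight
`t * maxDensity`, because the ratio of the weights increases. -/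
theorem tailMoment_mul_integral_curvatureDensity_le (n : ℕ) {N : ℕ} (hN : 2 ≤ N) :
    2 * tailMoment (n + 1) 1 (uniformVec N) * (∫ t in Set.Ioi (0 : ℝ), curvatureDensity n N t)
      ≤ tailMoment (n + 1) 0 (uniformVec N) *
        ∫ t in Set.Ioi (0 : ℝ), t * curvatureDensity n N t := by
  have hN0 : 0 < N := by omega
  have hN' : (0 : ℝ) < N := Nat.cast_pos.2 hN0
  have e0 := succ_mul_tailMoment_uniformVec n 0 hN0
  have e1 := succ_mul_tailMoment_uniformVec n 1 hN0
  have i1 := integrableOn_pow_mul_maxDensity n 1 hN0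
  have i2 := integrableOn_pow_mul_maxDensity n 2 hN0
  have k0 := integrableOn_pow_mul_curvatureDensity n 0 hN0
  have k1 := integrableOn_pow_mul_curvatureDensity n 1 hN0
  norm_num at e0 e1
  simp only [pow_zero, one_mul, pow_one] at i1 k0 k1
  have hJ0 : 0 < tailMoment (n + 1) 0 (uniformVec N) := by
    rw [e0]
    exact setIntegral_Ioi_pos i1 fun t ht => mul_pos ht (maxDensity_pos n hN0 ht)
  have hJ1 : 0 < 2 * tailMoment (n + 1) 1 (uniformVec N) := by
    rw [e1]
    exact setIntegral_Ioi_pos i2 fun t ht => mul_pos (pow_pos ht 2) (maxDensity_pos n hN0 ht)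
  set J0 := tailMoment (n + 1) 0 (uniformVec N)
  set J1 := tailMoment (n + 1) 1 (uniformVec N)
  -- `θ` is the mean of `t` under the weight `t * maxDensity`, so `t - θ` integrates to zero against
  -- that weight.
  set θ := 2 * J1 / J0 with hθ
  have hθ0 : 0 < θ := div_pos hJ1 hJ0
  set c : ℝ → ℝ := fun t => erlangCDFPrimitive n (1 / N * t) / erlangCDF (n + 1) (1 / N * t) with hc
  have hmono : MonotoneOn c (Set.Ioi 0) := fun s hs t ht hst =>
    monotoneOn_erlangCDFPrimitive_div n (Set.mem_Ioi.2 (mul_pos (by positivity) hs))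
      (Set.mem_Ioi.2 (mul_pos (by positivity) ht)) (by gcongr)
  have hle : ∫ t in Set.Ioi (0 : ℝ), N * (1 + c θ) *
        (t ^ 2 * maxDensity n N t - θ * (t * maxDensity n N t))
      ≤ ∫ t in Set.Ioi (0 : ℝ), (t * curvatureDensity n N t - θ * curvatureDensity n N t) := by
    refine setIntegral_mono_on ((i2.sub (i1.const_mul θ)).const_mul _) (k1.sub (k0.const_mul θ))
      measurableSet_Ioi fun t ht => ?_
    have ht : 0 < t := ht
    rw [curvatureDensity_eq n hN ht]
    -- Because `c` increases, `c t` may be replaced by the constant `c θ` at the cost of an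
    -- inequality; the resulting lower bound integrates to zero.
    have h1 : 0 ≤ (t - θ) * (c t - c θ) := by
      rcases le_total t θ with h | h
      · exact mul_nonneg_of_nonpos_of_nonpos (sub_nonpos.2 h) (sub_nonpos.2 (hmono ht hθ0 h))
      · exact mul_nonneg (sub_nonneg.2 h) (sub_nonneg.2 (hmono hθ0 ht h))
    have h2 : 0 ≤ N * (t * maxDensity n N t) :=
      mul_nonneg hN'.le (mul_pos ht (maxDensity_pos n hN0 ht)).le
    have h3 := mul_nonneg h2 h1
    change _ ≤ t * (N * (t * maxDensity n N t) * (1 + c t))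
      - θ * (N * (t * maxDensity n N t) * (1 + c t))
    linarith
  rw [integral_const_mul, integral_sub i2 (i1.const_mul θ), integral_sub k1 (k0.const_mul θ),
    integral_const_mul, integral_const_mul, ← e0, ← e1] at hle
  have hz : 2 * J1 - θ * J0 = 0 := by
    rw [hθ]
    field_simp
    ring
  rw [hz, mul_zero] at hle
  have := mul_nonneg hJ0.le hle
  have hz' : J0 * θ = 2 * J1 := by linarith
  rw [← hz']
  linarith

/-- The second derivative of `collectVar` at the uniform vector in a tangent direction of
norm one. -/
noncomputable def collectVarCurvature (n N : ℕ) : ℝ :=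
  2 * (∫ t in Set.Ioi (0 : ℝ), t * curvatureDensity n N t)
    - (∫ t in Set.Ioi (0 : ℝ), curvatureDensity n N t)
    - 2 * tailMoment (n + 1) 0 (uniformVec N) * ∫ t in Set.Ioi (0 : ℝ), curvatureDensity n N t

theorem collectVarCurvature_pos (n : ℕ) {N : ℕ} (hN : 2 ≤ N) : 0 < collectVarCurvature n N := by
  have hN0 : 0 < N := by omega
  have hle := tailMoment_mul_integral_curvatureDensity_le n hN
  have e0 := succ_mul_tailMoment_uniformVec n 0 hN0
  have i1 := integrableOn_pow_mul_maxDensity n 1 hN0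
  have k0 := integrableOn_pow_mul_curvatureDensity n 0 hN0
  norm_num at e0
  simp only [pow_zero, one_mul, pow_one] at i1 k0
  have hJ0 : 0 < tailMoment (n + 1) 0 (uniformVec N) := by
    rw [e0]
    exact setIntegral_Ioi_pos i1 fun t ht => mul_pos ht (maxDensity_pos n hN0 ht)
  have hK0 := setIntegral_Ioi_pos k0 fun t ht => curvatureDensity_pos n hN0 ht
  have hV := collectVar_eq (uniformVec_pos hN0) (sum_uniformVec hN0) (n + 1)
  have hV0 : 0 ≤ collectVar (n + 1) N (uniformVec N) := variance_nonneg _ _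
  rw [hV] at hV0
  rw [collectVarCurvature]
  set J0 := tailMoment (n + 1) 0 (uniformVec N)
  set J1 := tailMoment (n + 1) 1 (uniformVec N)
  set K0 := ∫ t in Set.Ioi (0 : ℝ), curvatureDensity n N t
  set K1 := ∫ t in Set.Ioi (0 : ℝ), t * curvatureDensity n N t
  -- Nonnegativity of the variance reads `J0 * (1 + J0) ≤ 2 * J1`.
  have h1 : J0 * ((1 + J0) * K0) ≤ J0 * K1 := by
    refine le_trans ?_ hle
    have := mul_nonneg hV0 hK0.le
    linarith
  have h2 := le_of_mul_le_mul_left h1 hJ0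
  -- `2 * K1 ≥ 2 * K0 + 2 * J0 * K0` leaves a surplus of `K0 > 0`, hence strictness.
  linarith

/-! ### The Hessian at the uniform vector. -/

/-- For a function already known to be `C²`, the Hessian on the diagonal is the second derivative
along a line. Smoothness can thus come from the closed form and the value from the integral formula.
-/
theorem iteratedFDeriv_two_apply_of_hasDerivAt_line {E : Type*} [NormedAddCommGroup E]
    [NormedSpace ℝ E] {f : E → ℝ} (hf : ContDiffAt ℝ 2 f 0) {h : E} {g : ℝ → ℝ} {v : ℝ}
    (hg : ∀ᶠ s in nhds (0 : ℝ), HasDerivAt (fun s : ℝ => f (s • h)) (g s) s)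
    (hv : HasDerivAt g v 0) : iteratedFDeriv ℝ 2 f 0 ![h, h] = v := by
  have hline : ∀ s : ℝ, HasDerivAt (fun s : ℝ => s • h) h s := fun s => by
    simpa using (hasDerivAt_id s).smul_const h
  have hd : ∀ᶠ x in nhds (0 : E), DifferentiableAt ℝ f x :=
    (hf.eventually (by simp)).mono fun x hx => hx.differentiableAt two_ne_zero
  have ht : Filter.Tendsto (fun s : ℝ => s • h) (nhds 0) (nhds 0) := by
    simpa using (hline 0).continuousAt.tendsto
  have hg' : g =ᶠ[nhds 0] fun s => fderiv ℝ f (s • h) h := by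
    filter_upwards [hg, ht.eventually hd] with s h1 h2
    have h3 : HasDerivAt (fun s : ℝ => f (s • h)) (fderiv ℝ f (s • h) h) s :=
      h2.hasFDerivAt.comp_hasDerivAt s (hline s)
    exact h1.unique h3
  have hdd : DifferentiableAt ℝ (fderiv ℝ f) 0 :=
    (hf.fderiv_right (m := 1) (by norm_num)).differentiableAt one_ne_zero
  have h2 : HasDerivAt (fun s : ℝ => fderiv ℝ f (s • h)) (fderiv ℝ (fderiv ℝ f) 0 h) 0 :=
    HasFDerivAt.comp_hasDerivAt_of_eq (0 : ℝ) hdd.hasFDerivAt (hline 0) (zero_smul ℝ h).symm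
  have h3 : HasDerivAt (fun s : ℝ => fderiv ℝ f (s • h) h) (fderiv ℝ (fderiv ℝ f) 0 h h) 0 := by
    simpa using h2.clm_apply (hasDerivAt_const (0 : ℝ) h)
  rw [iteratedFDeriv_two_apply]
  exact (h3.congr_of_eventuallyEq hg').unique hv

theorem sum_uniformVec_add {N : ℕ} (hN : 0 < N) (h : tangentDirections N) :
    ∑ i, (uniformVec N + (h : Fin N → ℝ)) i = 1 := by
  have hh : ∑ i, (h : Fin N → ℝ) i = 0 := h.2
  simp only [Pi.add_apply]
  rw [Finset.sum_add_distrib, sum_uniformVec hN, hh, add_zero]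

theorem collectVarAtUniform_eventuallyEq (m : ℕ) {N : ℕ} (hN : 0 < N) :
    collectVarAtUniform m N =ᶠ[nhds 0] fun h =>
      2 * tailMoment m 1 (uniformVec N + (h : Fin N → ℝ))
      - tailMoment m 0 (uniformVec N + (h : Fin N → ℝ))
      - tailMoment m 0 (uniformVec N + (h : Fin N → ℝ)) ^ 2 := by
  have hc : ContinuousAt (fun h : tangentDirections N => uniformVec N + (h : Fin N → ℝ)) 0 := by
    fun_prop
  have hp : ∀ᶠ q in nhds (uniformVec N + ((0 : tangentDirections N) : Fin N → ℝ)),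
      ∀ i, 0 < q i := eventually_forall_pos (by simpa using uniformVec_pos hN)
  filter_upwards [hc.eventually hp] with h hh
  exact collectVar_eq hh (sum_uniformVec_add hN h) m

theorem contDiffAt_collectVarAtUniform (m : ℕ) {N : ℕ} (hN : 0 < N) :
    ContDiffAt ℝ 2 (collectVarAtUniform m N) 0 := by
  refine ContDiffAt.congr_of_eventuallyEq ?_ (collectVarAtUniform_eventuallyEq m hN)
  have hT : ∀ j, ContDiffAt ℝ 2
      (fun h : tangentDirections N => tailMoment m j (uniformVec N + (h : Fin N → ℝ))) 0 := by
    intro j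
    refine ContDiffAt.comp (g := tailMoment m j)
      (0 : tangentDirections N) (contDiffAt_tailMoment m j ?_) ?_
    · simpa using uniformVec_pos hN
    · exact contDiffAt_const.add (tangentDirections N).subtypeL.contDiff.contDiffAt
  exact ((contDiffAt_const.mul (hT 1)).sub (hT 0)).sub ((hT 0).pow 2)

theorem iteratedFDeriv_collectVarAtUniform (n : ℕ) {N : ℕ} (hN : 2 ≤ N)
    (h : tangentDirections N) :
    iteratedFDeriv ℝ 2 (collectVarAtUniform (n + 1) N) 0 ![h, h]
      = collectVarCurvature n N * ∑ i, (h : Fin N → ℝ) i ^ 2 := by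
  have hN0 : 0 < N := by omega
  have hb : (0 : ℝ) < 1 / (2 * N) := by positivity
  have hh : ∑ i, (h : Fin N → ℝ) i = 0 := h.2
  obtain ⟨S, hSo, h0S, hS⟩ := eventually_line_mem_Ioo (uniformVec N) (h : Fin N → ℝ)
    fun _ => one_div_mem_Ioo hN0
  have hJ : ∀ j, ∀ s ∈ S, HasDerivAt
      (fun s : ℝ => tailMoment (n + 1) j (uniformVec N + s • (h : Fin N → ℝ))) _ s :=
    fun j s hs => (hasDerivAt_tailMoment_line n j _ _ hb hSo hS hs).2
  have hD : ∀ j, HasDerivAt _ _ (0 : ℝ) :=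
    fun j => hasDerivAt_integral_prodCDFDeriv_line n j _ _ hb hSo hS h0S
  have hfun : ∀ s ∈ S, collectVarAtUniform (n + 1) N (s • h)
      = 2 * tailMoment (n + 1) 1 (uniformVec N + s • (h : Fin N → ℝ))
      - tailMoment (n + 1) 0 (uniformVec N + s • (h : Fin N → ℝ))
      - tailMoment (n + 1) 0 (uniformVec N + s • (h : Fin N → ℝ)) ^ 2 := fun s hs =>
    collectVar_eq (fun i => hb.trans (hS s hs i).1) (sum_uniformVec_add hN0 (s • h)) (n + 1)
  refine iteratedFDeriv_two_apply_of_hasDerivAt_line (contDiffAt_collectVarAtUniform (n + 1) hN0)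
    (Filter.mem_of_superset (hSo.mem_nhds h0S) fun s hs =>
      ((((hJ 1 s hs).const_mul 2).fun_sub (hJ 0 s hs)).fun_sub
        ((hJ 0 s hs).fun_pow 2)).congr_of_eventuallyEq
        (Filter.mem_of_superset (hSo.mem_nhds hs) hfun)) ?_
  have h2 := (((hD 1).const_mul 2).fun_sub (hD 0)).fun_sub
    (((hJ 0 0 h0S).const_mul 2).fun_mul (hD 0))
  have e1 := prodCDFDeriv_uniformVec n hh
  have e2 := prodCDFDeriv₂_uniformVec hN n hh
  have e3 : ∀ t : ℝ, -(t ^ 1 * -((∑ i, (h : Fin N → ℝ) i ^ 2) * curvatureDensity n N t))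
      = (∑ i, (h : Fin N → ℝ) i ^ 2) * (t * curvatureDensity n N t) := fun t => by ring
  have e4 : ∀ t : ℝ, -(t ^ 0 * -((∑ i, (h : Fin N → ℝ) i ^ 2) * curvatureDensity n N t))
      = (∑ i, (h : Fin N → ℝ) i ^ 2) * curvatureDensity n N t := fun t => by ring
  -- The first derivative of `J_0` vanishes at `s = 0`, so its square drops out and `J_0 ^ 2`
  -- contributes only `2 * J_0 * J_0''`.
  simp only [zero_smul, add_zero, e1, e2] at h2
  simp only [e3, e4, mul_zero, neg_zero, integral_zero, zero_add,
    integral_const_mul] at h2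
  refine (h2.congr_deriv ?_).congr_of_eventuallyEq (Filter.Eventually.of_forall fun s => ?_)
  · rw [collectVarCurvature]
    ring
  · simp

theorem mainTheorem9 (m N : ℕ) (hm : 1 ≤ m) (hN : 2 ≤ N) :
    (∀ p : Fin N → ℝ, (∀ i, 0 < p i) → ∑ i, p i = 1 →
      (∀ᵐ ω ∂(drawLaw p), ∃ n, HasCompleteSets m ω n) ∧
      MemLp (fun ω : ℕ → Fin N => (collectTime m ω : ℝ)) 2 (drawLaw p)) ∧
    ContDiffAt ℝ 2 (collectVarAtUniform m N) 0 ∧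
    ∃ C : ℝ, 0 < C ∧ ∀ h : tangentDirections N,
      iteratedFDeriv ℝ 2 (collectVarAtUniform m N) 0 ![h, h]
        = C * ∑ i, (h : Fin N → ℝ) i ^ 2 := by
  -- The density of the `m`-th Poisson point is `poissonMass (m - 1)`, hence the shift to `n + 1`.
  obtain ⟨n, rfl⟩ : ∃ n, m = n + 1 := ⟨m - 1, by omega⟩
  exact ⟨fun p hp h1 => ⟨ae_exists_hasCompleteSets hp h1 _, memLp_collectTime hp h1 _⟩,
    contDiffAt_collectVarAtUniform _ (by omega),
    collectVarCurvature n N, collectVarCurvature_pos n hN,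
    iteratedFDeriv_collectVarAtUniform n hN⟩
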